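/- **Notation.** For $n\ge 1$ let $\mu=(\mu_1,\dots,\mu_{n-1})\in\mathbb N^{n-1}$ run over the tuples with $\mu_1+2\mu_2+\cdots+(n-1)\mu_{n-1}=n$, and put $|\mu|=\mu_1+\cdots+\mu_{n-1}$. Let $\mathcal J=(\mathcal J^n_\mu)$ be a family of polynomials with integer coefficients in variables $R_{i,j}$. For a polynomial $R(x,y)$ over $\mathbb C$ and a germ of holomorphic map $\zeta\mapsto(x(\zeta),y(\zeta))$ with $R(x(\zeta),y(\zeta))\equiv 0$, put $$A^n_R=\frac{y^{(n)}}{R_x}+\sum_{\mu}\frac{(y')^{\mu_1}\cdots(y^{(n-1)})^{\mu_{n-1}}}{R_x}\,\mathcal J^n_\mu\Big(R_{i,j}:=\frac{R_{x^iy^j}}{R_x}\Big)\quad\text{where }R_x\neq0,$$ $$B^n_R=-\frac{x^{(n)}}{R_y}-\sum_{\mu}\frac{(x')^{\mu_1}\cdots(x^{(n-1)})^{\mu_{n-1}}}{R_y}\,\mathcal J^n_\mu\Big(R_{i,j}:=\frac{R_{y^ix^j}}{R_y}\Big)\quad\text{where }R_y\neq0 .$$ Call $\mathcal J$ a *generating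 family* if, for all $n\ge1$ and all $\mu$: (a) $\mathcal J^n_\mu$ involves only $R_{0,1}$ and the $R_{i,j}$ with $2\le i+j\le|\mu|$; (b) each of its monomials $(R_{0,1})^hR_{i_1,j_1}\cdots R_{i_\nu,j_\nu}$ (all $i_k+j_k\ge2$) satisfies $\sum_k(i_k+j_k-1)=|\mu|-1$; (c) for every $R$ and every germ as above, $A^n_R=B^n_R$ wherever $R_x\ne0\ne R_y$. The *canonical family* is obtained from $y'/R_x$ by differentiating $n-1$ times along the curve, replacing $x'$ by $-y'R_y/R_x$ at each step, multiplying the result by $R_x$, and taking for $\mathcal J^n_\mu$ the coefficient of $(y')^{\mu_1}\cdots(y^{(n-1)})^{\mu_{n-1}}$. **Theorem.** (1) The canonical family is a generating family. (2) Let $\mathcal J$ be any generating family, $\kappa\ge1$, $d\ge\kappa+3$, and let $X\subset\mathbb P^2(\mathbb C)$ be a smooth curve given by a homogeneous polynomial $F(T,X,Y)$ of degree $d$ (so $F,F_T,F_X,F_Y$ have no common zero in $\mathbb P^2$), in adapted homogeneous coordinates $[T:X:Y]$: $[0:1:0]\notin X$, $[0:0:1]\notin X$, and the line $\mathbb P^1_\infty=\{T=0\}$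 meets $X$ transversally in $d$ distinct points. Put $x=X/T$, $y=Y/T$ and $R(x,y)=F(1,x,y)$. Then for every $1\le\lambda\le\kappa$ the expression $$J^\lambda_R=\begin{cases}A^\lambda_R&\text{on }X\cap\mathbb C^2\cap\{R_x\ne0\},\\ B^\lambda_R&\text{on }X\cap\mathbb C^2\cap\{R_y\ne0\},\\ 0&\text{on }X\cap\mathbb P^1_\infty,\end{cases}$$ is a well-defined function of germs $f:(\mathbb C,0)\to X$ of holomorphic maps, and is a holomorphic $\lambda$-jet differential on the whole of $X$ which vanishes identically on $X\cap\mathbb P^1_\infty$. That is, in every local holomorphic coordinate $t$ of $X$ it is $$\sum_{\nu_1+2\nu_2+\cdots+\lambda\nu_\lambda=\lambda}a_\nu(t)\,(t')^{\nu_1}\cdots(t^{(\lambda)})^{\nu_\lambda}$$ with holomorphic coefficients $a_\nu$, and every $a_\nu$ vanishes at the points of $X\cap\mathbb P^1_\infty$. -/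

import Mathlib

open Filter Topology

noncomputable section

/-! ## The projective plane, plane curves, adapted coordinates -/

/-- The complex projective plane with homogeneous coordinates `[T : X : Y]`
(indices `0`, `1`, `2`). -/
abbrev P2 : Type := Projectivization ℂ (Fin 3 → ℂ)

/-- The zero locus in the projective plane of a homogeneous polynomial `F(T, X, Y)`. -/
def planeCurve (F : MvPolynomial (Fin 3) ℂ) : Set P2 :=
  {p | MvPolynomial.eval p.rep F = 0}

/-- The line at infinity `{T = 0}`. -/
def lineAtInfinity : Set P2 := {p | p.rep 0 = 0}

/-- The affine coordinate `x = X / T` (meaningful off the line at infinity). -/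
def affX (p : P2) : ℂ := p.rep 1 / p.rep 0

/-- The affine coordinate `y = Y / T` (meaningful off the line at infinity). -/
def affY (p : P2) : ℂ := p.rep 2 / p.rep 0

/-- The affine equation `R(x, y) = F(1, x, y)`. -/
def affineEq (F : MvPolynomial (Fin 3) ℂ) : MvPolynomial (Fin 2) ℂ :=
  MvPolynomial.aeval ![1, MvPolynomial.X 0, MvPolynomial.X 1] F

/-- `F` is a homogeneous polynomial of degree `d` whose zero locus is geometrically smooth:
`F`, `F_T`, `F_X`, `F_Y` have no common zero in the projective plane. -/
structure IsSmoothPlaneCurve (F : MvPolynomial (Fin 3) ℂ) (d : ℕ) : Prop where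
  homogeneous : F.IsHomogeneous d
  smooth : ∀ v : Fin 3 → ℂ, v ≠ 0 → MvPolynomial.eval v F = 0 →
    ∃ i, MvPolynomial.eval v (MvPolynomial.pderiv i F) ≠ 0

/-- The coordinates are adapted to the curve `F = 0` of degree `d`: the points
`[0 : 1 : 0]` and `[0 : 0 : 1]` are not on the curve, and the line at infinity meets the
curve in exactly `d` distinct points, at each of which the intersection is transversal
(the tangent line `F_T T + F_X X + F_Y Y = 0` is not the line `T = 0`). -/
structure IsAdapted (F : MvPolynomial (Fin 3) ℂ) (d : ℕ) : Prop where
  inftyX_notMem : MvPolynomial.eval ![0, 1, 0] F ≠ 0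
  inftyY_notMem : MvPolynomial.eval ![0, 0, 1] F ≠ 0
  card_infinity : (planeCurve F ∩ lineAtInfinity).ncard = d
  transversal : ∀ p ∈ planeCurve F ∩ lineAtInfinity,
    MvPolynomial.eval p.rep (MvPolynomial.pderiv 1 F) ≠ 0 ∨
      MvPolynomial.eval p.rep (MvPolynomial.pderiv 2 F) ≠ 0

/-! ## Holomorphic maps to a plane curve and jet differentials -/

/-- A map from (an open part of) `ℂ` to the projective plane is holomorphic at `z` when, near
`z`, it is represented by homogeneous coordinates which are holomorphic and do not vanish
simultaneously. -/
def HolomorphicAtP2 (f : ℂ → P2) (z : ℂ) : Prop :=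
  ∃ v : ℂ → Fin 3 → ℂ, AnalyticAt ℂ v z ∧
    ∀ᶠ w in 𝓝 z, ∃ h : v w ≠ 0, f w = Projectivization.mk ℂ (v w) h

/-- A germ at `0` of a holomorphic map with values in the curve `X`. -/
structure IsCurveGerm (X : Set P2) (f : ℂ → P2) : Prop where
  holomorphic : HolomorphicAtP2 f 0
  mem : ∀ᶠ z in 𝓝 (0 : ℂ), f z ∈ X

/-- A local holomorphic parametrization (inverse of a local holomorphic coordinate) of the
curve `X`: an injective holomorphic map from an open set `U ⊆ ℂ` to `X`. -/
structure IsLocalParam (X : Set P2) (U : Set ℂ) (φ : ℂ → P2) : Prop where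
  isOpen : IsOpen U
  holomorphic : ∀ t ∈ U, HolomorphicAtP2 φ t
  mapsTo : ∀ t ∈ U, φ t ∈ X
  injOn : Set.InjOn φ U

/-- For a function `ω` of germs at `0` of holomorphic maps to the curve, and a local
parametrization `φ` on `U`: in the jet coordinates `(t; t', t'', …, t^(k))` attached to the local
coordinate `t`, the function `ω` is the polynomial
`∑ a_μ(t) (t')^μ₁ (t'')^μ₂ ⋯ (t^(k))^μ_k`, the sum over `μ₁ + 2 μ₂ + ⋯ + k μ_k = m`.
A tuple `μ` with this property is the partition of `m` with `μ_j` parts equal to `j`, with all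
parts at most `k`. In particular `ω` depends only on the `k`-jet of the germ. -/
def IsLocalExpansion (k m : ℕ) (ω : (ℂ → P2) → ℂ) (U : Set ℂ) (φ : ℂ → P2)
    (a : Nat.Partition m → ℂ → ℂ) : Prop :=
  ∀ g : ℂ → ℂ, AnalyticAt ℂ g 0 → g 0 ∈ U →
    ω (φ ∘ g) = ∑ p : Nat.Partition m with ∀ j ∈ p.parts, j ≤ k,
      a p (g 0) * (p.parts.map fun j => iteratedDeriv j g 0).prod

/-- `ω` is a holomorphic jet differential of order `k` and weighted degree `m` on the whole
curve `X`, that is, a global holomorphic section of the Green–Griffiths bundle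
`E_{k,m} T^*_X`: in every local coordinate its coefficients are holomorphic. -/
def IsHolomorphicJetDifferential (X : Set P2) (k m : ℕ) (ω : (ℂ → P2) → ℂ) : Prop :=
  ∀ (U : Set ℂ) (φ : ℂ → P2), IsLocalParam X U φ →
    ∃ a : Nat.Partition m → ℂ → ℂ,
      (∀ p, DifferentiableOn ℂ (a p) U) ∧ IsLocalExpansion k m ω U φ a

/-- The jet differential `ω` (of order `k` and weighted degree `m`) on `X` vanishes identically
on the set `D`: in every local coordinate all its coefficients vanish at the points of `D`. -/
def VanishesOn (X : Set P2) (k m : ℕ) (ω : (ℂ → P2) → ℂ) (D : Set P2) : Prop :=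
  ∀ (U : Set ℂ) (φ : ℂ → P2), IsLocalParam X U φ →
    ∀ a : Nat.Partition m → ℂ → ℂ, IsLocalExpansion k m ω U φ a →
      ∀ t ∈ U, φ t ∈ D → ∀ p : Nat.Partition m, (∀ j ∈ p.parts, j ≤ k) → a p t = 0

/-! ## The two symmetric expressions -/

/-- The value at `(x, y)` of the partial derivative `R_{x^i y^j}`. -/
def partialDeriv (R : MvPolynomial (Fin 2) ℂ) (i j : ℕ) (x y : ℂ) : ℂ :=
  MvPolynomial.eval ![x, y]
    ((MvPolynomial.pderiv 0)^[i] ((MvPolynomial.pderiv 1)^[j] R))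

/-- A family of polynomials with integer coefficients in variables `R_{i,j}`. The member
indexed by the order `n` and by the exponents `μ₁, …, μ_{n-1}` with
`μ₁ + 2 μ₂ + ⋯ + (n-1) μ_{n-1} = n` is attached to the partition of `n` with `μ_j` parts
equal to `j` (all parts less than `n`; the value at the partition with one part is not
used). -/
abbrev JetFamily : Type :=
  (n : ℕ) → Nat.Partition n → MvPolynomial (ℕ × ℕ) ℤ

/-- `z^(n) / D + ∑ ((z')^μ₁ ⋯ (z^(n-1))^μ_{n-1} / D) 𝒥_μ(r)`, the sum over
`μ₁ + 2 μ₂ + ⋯ + (n-1) μ_{n-1} = n`. -/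
def sideExpr (J : JetFamily) (n : ℕ) (D : ℂ) (r : ℕ × ℕ → ℂ) (z : ℕ → ℂ) : ℂ :=
  z n / D + ∑ p : Nat.Partition n with ∀ j ∈ p.parts, j < n,
    (p.parts.map z).prod / D * MvPolynomial.aeval r (J n p)

/-- The expression in the jets of `y`, with divisions by `R_x` only, at `ζ = 0` along
`ζ ↦ (x(ζ), y(ζ))`. -/
def ySide (J : JetFamily) (n : ℕ) (R : MvPolynomial (Fin 2) ℂ) (x y : ℂ → ℂ) : ℂ :=
  sideExpr J n (partialDeriv R 1 0 (x 0) (y 0))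
    (fun s => partialDeriv R s.1 s.2 (x 0) (y 0) / partialDeriv R 1 0 (x 0) (y 0))
    (fun k => iteratedDeriv k y 0)

/-- The expression in the jets of `x`, with divisions by `R_y` only, obtained from `ySide` by
the exchange of `x` and `y` and a global minus sign. -/
def xSide (J : JetFamily) (n : ℕ) (R : MvPolynomial (Fin 2) ℂ) (x y : ℂ → ℂ) : ℂ :=
  -sideExpr J n (partialDeriv R 0 1 (x 0) (y 0))
    (fun s => partialDeriv R s.2 s.1 (x 0) (y 0) / partialDeriv R 0 1 (x 0) (y 0))
    (fun k => iteratedDeriv k x 0)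

/-- The families of polynomials which give rise to generating jet differentials: the polynomial
`𝒥_μ` involves only `R_{0,1}` and the `R_{i,j}` with `2 ≤ i + j ≤ |μ|`, where
`|μ| = μ₁ + ⋯ + μ_{n-1}`; each of its monomials `(R_{0,1})^h R_{i₁,j₁} ⋯ R_{i_ν,j_ν}` has
`(i₁ + j₁ - 1) + ⋯ + (i_ν + j_ν - 1) = |μ| - 1`; and the expression in the jets of `y` is equal
to the symmetric expression in the jets of `x` along every holomorphic `(x(ζ), y(ζ))` with
`R(x(ζ), y(ζ)) = 0`, where `R_x` and `R_y` do not vanish. -/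
structure IsGeneratingFamily (J : JetFamily) : Prop where
  vars_mem : ∀ n, 1 ≤ n → ∀ p : Nat.Partition n, (∀ j ∈ p.parts, j < n) →
    ∀ s ∈ (J n p).vars, s = (0, 1) ∨ (2 ≤ s.1 + s.2 ∧ s.1 + s.2 ≤ p.parts.card)
  weight_eq : ∀ n, 1 ≤ n → ∀ p : Nat.Partition n, (∀ j ∈ p.parts, j < n) →
    ∀ e ∈ (J n p).support, (e.sum fun s h => h * (s.1 + s.2 - 1)) = p.parts.card - 1
  symmetric_eq : ∀ n, 1 ≤ n → ∀ (R : MvPolynomial (Fin 2) ℂ) (x y : ℂ → ℂ),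
    AnalyticAt ℂ x 0 → AnalyticAt ℂ y 0 →
    (∀ᶠ z in 𝓝 (0 : ℂ), MvPolynomial.eval ![x z, y z] R = 0) →
    partialDeriv R 1 0 (x 0) (y 0) ≠ 0 → partialDeriv R 0 1 (x 0) (y 0) ≠ 0 →
    ySide J n R x y = xSide J n R x y

/-! ## The family obtained by successive differentiation of `y' / R_x = - x' / R_y` -/

/-- Formal differentiation along the curve, in terms of the jet variables `y^(k)` (variable
`Sum.inl k`) and of the quotients `r_{i,j} = R_{x^i y^j} / R_x` (variable `Sum.inr (i, j)`),
after the replacement of `x'` by `- y' R_y / R_x`. -/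
def formalD : Derivation ℤ (MvPolynomial (ℕ ⊕ ℕ × ℕ) ℤ) (MvPolynomial (ℕ ⊕ ℕ × ℕ) ℤ) :=
  let Y (k : ℕ) : MvPolynomial (ℕ ⊕ ℕ × ℕ) ℤ := MvPolynomial.X (Sum.inl k)
  let r (i j : ℕ) : MvPolynomial (ℕ ⊕ ℕ × ℕ) ℤ := MvPolynomial.X (Sum.inr (i, j))
  MvPolynomial.mkDerivation ℤ fun v => match v with
    | Sum.inl k => Y (k + 1)
    | Sum.inr (i, j) => Y 1 * (r i (j + 1) - r 0 1 * r (i + 1) j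
        - r i j * (r 1 1 - r 0 1 * r 2 0))

/-- `R_x` times the expression obtained from `y' / R_x` by `n - 1` differentiations (`n ≥ 1`).
The second term of the recursion is the derivative of the denominator `R_x`. -/
def genPoly : ℕ → MvPolynomial (ℕ ⊕ ℕ × ℕ) ℤ
  | 0 => 0
  | 1 => MvPolynomial.X (Sum.inl 1)
  | n + 2 => formalD (genPoly (n + 1))
      - MvPolynomial.X (Sum.inl 1) *
        (MvPolynomial.X (Sum.inr (1, 1))
          - MvPolynomial.X (Sum.inr (0, 1)) * MvPolynomial.X (Sum.inr (2, 0))) *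
        genPoly (n + 1)

/-- The coefficient of the jet monomial `(y')^μ₁ ⋯ (y^(n-1))^μ_{n-1}` in `genPoly n`. -/
def canonicalFamily : JetFamily := fun n p =>
  (MvPolynomial.sumAlgEquiv ℤ ℕ (ℕ × ℕ) (genPoly n)).coeff (Multiset.toFinsupp p.parts)

end

/-!
The proof has two independent parts.

*The canonical family is generating.* On a curve `R(x, y) = 0` one has `y' / R_x = -x' / R_y`, and
`genPoly n / R_x` is the derivative of order `n - 1` of the left side (`aeval_genPoly_div`). The
exchange of `x` and `y` turns it into the derivative of the right side, which gives the symmetry.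
The conditions on the exponents say that `genPoly n` is homogeneous for the bigrading `jetWeight`
and involves only the variables in `jetVars`; both properties are preserved by the derivation
`formalD`. The coefficient of `y^(n)` is `1`, since the rest of `genPoly n` lies in the square of
the ideal generated by the jets.

*The jet differential extends by zero to infinity.* In a local coordinate `t` of the curve, Faà di
Bruno's formula expands the expression in the jets of `y` (or of `x`) into jet monomials of the
coordinate, with coefficients which are holomorphic on the affine part. Let `t₀` be a point at
infinity, where `T` vanishes to order `m ≥ 1`. There `y^(k)` has a pole of order at most `m + k`,
the quotient `R_{x^i y^j} / R_x` has order at least `m (i + j - 1)`, because `R_{x^i y^j}` comes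
from a form of degree `d - i - j`, and `1 / R_x` has order `m (d - 1)`. By the condition on the
exponents of a generating family, the factor `𝒥_μ` compensates all but one of the `|μ|` poles of
order `m` of the jet monomial, so that all coefficients have order at least
`m (d - 1) - m - n = m (d - 2) - n > 0` (`isJetPoly_sideExpr`, `isJetPoly_curveJetDiff_infinity`).
The same count with all orders replaced by `0` gives holomorphy at the affine points, so that both
cases are treated by means of an abstract filtration `IsOrderFiltration`. Finally the jet monomials
are linearly independent (`eq_of_jetMonomial_sum_eq`): hence the local coefficients are unique, they
glue, and they vanish wherever the jet differential vanishes on all germs.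
-/

noncomputable section

open MvPolynomial

/-! ### Derivations of polynomial rings -/

namespace MvPolynomial

variable {σ : Type*}

/-- If the derivation `D` computes the derivatives of the functions substituted for the variables,
then it computes the derivatives of all polynomials in these functions. -/
theorem hasDerivAt_aeval (D : Derivation ℤ (MvPolynomial σ ℤ) (MvPolynomial σ ℤ))
    (v : ℂ → σ → ℂ) (z : ℂ)
    (h : ∀ i, HasDerivAt (fun w => v w i) (aeval (v z) (D (X i))) z) (p : MvPolynomial σ ℤ) :
    HasDerivAt (fun w => aeval (v w) p) (aeval (v z) (D p)) z := by
  induction p using MvPolynomial.induction_on with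
  | C a => simpa using hasDerivAt_const z (a : ℂ)
  | add p q hp hq => simp only [map_add]; exact hp.fun_add hq
  | mul_X p i hp =>
    have := hp.fun_mul (h i)
    simp only [map_mul, aeval_X, Derivation.leibniz, smul_eq_mul, map_add]
    refine this.congr_deriv ?_
    ring

/-- A derivation that shifts the weights of the variables by `δ` shifts all weights by `δ`. -/
theorem IsWeightedHomogeneous.derivation {M : Type*} [AddCommMonoid M] {w : σ → M} {δ : M}
    (D : Derivation ℤ (MvPolynomial σ ℤ) (MvPolynomial σ ℤ))
    (hD : ∀ i, IsWeightedHomogeneous w (D (X i)) (w i + δ)) {p : MvPolynomial σ ℤ} {m : M}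
    (hp : IsWeightedHomogeneous w p m) : IsWeightedHomogeneous w (D p) (m + δ) := by
  classical
  have hmul : ∀ a b : MvPolynomial σ ℤ, ∀ m n : M, IsWeightedHomogeneous w a m →
      IsWeightedHomogeneous w b n → IsWeightedHomogeneous w (D a) (m + δ) →
      IsWeightedHomogeneous w (D b) (n + δ) → IsWeightedHomogeneous w (D (a * b)) (m + n + δ) := by
    intro a b m n ha hb hDa hDb
    rw [Derivation.leibniz, smul_eq_mul, smul_eq_mul]
    refine IsWeightedHomogeneous.add ?_ ?_
    · simpa [add_assoc] using ha.mul hDb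
    · convert hb.mul hDa using 1
      abel
  have hone : IsWeightedHomogeneous w (D 1) (0 + δ) := by
    simpa using isWeightedHomogeneous_zero ℤ w δ
  have hmon : ∀ s : σ →₀ ℕ,
      IsWeightedHomogeneous w (D (monomial s 1)) (Finsupp.weight w s + δ) := by
    intro s
    induction s using Finsupp.induction_linear with
    | zero => simpa using hone
    | add f g hf hg =>
      rw [show (monomial (f + g) (1 : ℤ)) = monomial f 1 * monomial g 1 by simp, map_add]
      exact hmul _ _ _ _ (isWeightedHomogeneous_monomial _ _ _ rfl)
        (isWeightedHomogeneous_monomial _ _ _ rfl) hf hg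
    | single i k =>
      induction k with
      | zero => simpa using hone
      | succ k ih =>
        rw [Finsupp.single_add, show (monomial (Finsupp.single i k + Finsupp.single i 1) (1 : ℤ))
          = monomial (Finsupp.single i k) 1 * X i by simp [X], map_add]
        refine hmul _ _ _ _ (isWeightedHomogeneous_monomial _ _ _ rfl) ?_ ih ?_
        · simpa [Finsupp.weight_single] using isWeightedHomogeneous_X ℤ w i
        · simpa [Finsupp.weight_single] using hD i
  rw [p.as_sum, map_sum]
  refine IsWeightedHomogeneous.sum _ _ _ fun s hs => ?_
  have hs' : Finsupp.weight w s = m := hp (mem_support_iff.mp hs)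
  rw [← hs', ← mul_one (coeff s p), ← smul_eq_mul, ← smul_monomial, D.map_smul,
    smul_eq_C_mul]
  exact (hmon s).C_mul _

/-- A derivation which maps the variables in `s` to polynomials in these variables preserves the
polynomials in these variables. -/
theorem derivation_mem_supported (D : Derivation ℤ (MvPolynomial σ ℤ) (MvPolynomial σ ℤ))
    {s : Set σ} (hD : ∀ i ∈ s, D (X i) ∈ supported ℤ s) {p : MvPolynomial σ ℤ}
    (hp : p ∈ supported ℤ s) : D p ∈ supported ℤ s := by
  induction hp using Algebra.adjoin_induction with
  | mem x hx => obtain ⟨i, hi, rfl⟩ := hx; exact hD i hi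
  | algebraMap r => rw [D.map_algebraMap]; exact zero_mem _
  | add x y hx hy h1 h2 => rw [map_add]; exact add_mem h1 h2
  | mul x y hx hy h1 h2 =>
    rw [Derivation.leibniz]
    exact add_mem (mul_mem hx h2) (mul_mem hy h1)

/-- A derivation preserves the square of an ideal generated by a set which it maps to the ideal. -/
theorem derivation_mem_sq (D : Derivation ℤ (MvPolynomial σ ℤ) (MvPolynomial σ ℤ))
    {s : Set (MvPolynomial σ ℤ)} (hD : ∀ x ∈ s, D x ∈ Ideal.span s) {p : MvPolynomial σ ℤ}
    (hp : p ∈ Ideal.span s ^ 2) : D p ∈ Ideal.span s ^ 2 := by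
  have h1 : ∀ x ∈ Ideal.span s, D x ∈ Ideal.span s := by
    intro x hx
    induction hx using Submodule.span_induction with
    | mem x hx => exact hD x hx
    | zero => simp
    | add x y _ _ h1 h2 => rw [map_add]; exact add_mem h1 h2
    | smul a x hx h =>
      rw [smul_eq_mul, Derivation.leibniz]
      exact add_mem (Ideal.mul_mem_left _ _ h) (Ideal.mul_mem_right _ _ hx)
  rw [sq] at hp ⊢
  induction hp using Submodule.mul_induction_on' with
  | mem_mul_mem a ha b hb =>
    rw [Derivation.leibniz]
    refine add_mem (Ideal.mul_mem_mul ha (h1 b hb)) ?_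
    rw [smul_eq_mul, mul_comm b]
    exact Ideal.mul_mem_mul (h1 a ha) hb
  | add x _ y _ hx hy => rw [map_add]; exact add_mem hx hy

theorem sumAlgEquiv_monomial {τ : Type*} (s : σ ⊕ τ →₀ ℕ) (r : ℤ) :
    sumAlgEquiv ℤ σ τ (monomial s r) =
      monomial (Finsupp.sumFinsuppAddEquivProdFinsupp s).1
        (monomial (Finsupp.sumFinsuppAddEquivProdFinsupp s).2 r) := by
  simp [sumAlgEquiv, monomial]

theorem coeff_coeff_sumAlgEquiv {τ : Type*} (p : MvPolynomial (σ ⊕ τ) ℤ) (m : σ →₀ ℕ)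
    (e : τ →₀ ℕ) :
    coeff e (coeff m (sumAlgEquiv ℤ σ τ p)) = coeff (Finsupp.sumElim m e) p := by
  classical
  induction p using MvPolynomial.induction_on' with
  | add p q hp hq => simp only [map_add, coeff_add, hp, hq]
  | monomial s r =>
    have h : s = Finsupp.sumElim m e ↔ (Finsupp.sumFinsuppAddEquivProdFinsupp s).1 = m ∧
        (Finsupp.sumFinsuppAddEquivProdFinsupp s).2 = e := by
      constructor
      · rintro rfl
        exact ⟨by ext; rfl, by ext; rfl⟩
      · rintro ⟨rfl, rfl⟩
        ext (i | i) <;> rfl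
    rw [sumAlgEquiv_monomial, coeff_monomial, coeff_monomial]
    simp only [h]
    by_cases h1 : (Finsupp.sumFinsuppAddEquivProdFinsupp s).1 = m
    · simp only [h1, if_true, true_and, coeff_monomial]
    · simp only [h1, if_false, false_and, coeff_zero]

theorem aeval_sumElim_eq_sum {τ : Type*} (z : σ → ℂ) (r : τ → ℂ) (p : MvPolynomial (σ ⊕ τ) ℤ) :
    aeval (Sum.elim z r) p =
      ∑ m ∈ (sumAlgEquiv ℤ σ τ p).support,
        (∏ i ∈ m.support, z i ^ m i) * aeval r (coeff m (sumAlgEquiv ℤ σ τ p)) := by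
  have h : (aeval (Sum.elim z r) : MvPolynomial (σ ⊕ τ) ℤ →ₐ[ℤ] ℂ).toRingHom =
      (eval₂Hom (aeval r : MvPolynomial τ ℤ →ₐ[ℤ] ℂ).toRingHom z).comp
        (sumAlgEquiv ℤ σ τ).toAlgHom.toRingHom := by
    refine ringHom_ext (fun a => by simp) ?_
    rintro (i | i) <;> simp
  have h2 := RingHom.congr_fun h p
  simp only [AlgHom.toRingHom_eq_coe, RingHom.coe_coe, RingHom.comp_apply, coe_eval₂Hom] at h2
  rw [h2]
  refine (eval₂_eq _ _ _).trans ?_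
  exact Finset.sum_congr rfl fun m _ => mul_comm _ _

end MvPolynomial

/-! ### The shape of the canonical polynomials -/

/-- The bigrading of the jet variables and of the quotients `r_{i,j} = R_{x^i y^j} / R_x`: the first
component counts derivatives, the second one is the degree under the scaling of `x` and `y` by a
common factor, for which `y^(k)` has degree `1` and `r_{i,j}` has degree `1 - (i + j)`. -/
def jetWeight : ℕ ⊕ ℕ × ℕ → ℤ × ℤ :=
  Sum.elim (fun k => ((k : ℤ), 1)) (fun s => (0, 1 - (s.1 + s.2 : ℤ)))

/-- The jet variables `y^(k)` with `k ≥ 1`, the variable `r_{0,1}`, and the variables `r_{i,j}` with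
`i + j ≥ 2`. In particular `r_{1,0}`, whose value is `1`, is excluded. -/
def jetVars : Set (ℕ ⊕ ℕ × ℕ) :=
  {v | Sum.elim (fun k => 1 ≤ k) (fun s : ℕ × ℕ => s = (0, 1) ∨ 2 ≤ s.1 + s.2) v}


theorem formalD_inl (k : ℕ) : formalD (X (Sum.inl k)) = X (Sum.inl (k + 1)) := by
  simp [formalD]

theorem formalD_inr (i j : ℕ) : formalD (X (Sum.inr (i, j))) =
    X (Sum.inl 1) * (X (Sum.inr (i, j + 1)) - X (Sum.inr (0, 1)) * X (Sum.inr (i + 1, j))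
      - X (Sum.inr (i, j)) *
        (X (Sum.inr (1, 1)) - X (Sum.inr (0, 1)) * X (Sum.inr (2, 0)))) := by
  simp [formalD]

theorem genPoly_isWeightedHomogeneous (n : ℕ) :
    IsWeightedHomogeneous jetWeight (genPoly (n + 1)) ((n : ℤ) + 1, 1) := by
  have hX : ∀ (v : ℕ ⊕ ℕ × ℕ) (m : ℤ × ℤ), jetWeight v = m →
      IsWeightedHomogeneous jetWeight (X v : MvPolynomial (ℕ ⊕ ℕ × ℕ) ℤ) m := by
    rintro v m rfl
    exact isWeightedHomogeneous_X _ _ _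
  have hmul : ∀ (p q : MvPolynomial (ℕ ⊕ ℕ × ℕ) ℤ) (a b c : ℤ × ℤ),
      IsWeightedHomogeneous jetWeight p a → IsWeightedHomogeneous jetWeight q b → a + b = c →
      IsWeightedHomogeneous jetWeight (p * q) c := by
    rintro p q a b c hp hq rfl
    exact hp.mul hq
  have hR : IsWeightedHomogeneous jetWeight (X (Sum.inr (1, 1)) -
      X (Sum.inr (0, 1)) * X (Sum.inr (2, 0)) : MvPolynomial (ℕ ⊕ ℕ × ℕ) ℤ) (0, -1) :=
    (hX _ _ (by simp [jetWeight])).sub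
      (hmul _ _ 0 _ _ (hX _ _ (by simp [jetWeight])) (hX _ _ rfl) (by simp [jetWeight]))
  have hD : ∀ v, IsWeightedHomogeneous jetWeight (formalD (X v)) (jetWeight v + (1, 0)) := by
    rintro (k | ⟨i, j⟩)
    · rw [formalD_inl]
      exact hX _ _ (by simp [jetWeight])
    · rw [formalD_inr]
      refine hmul _ _ (1, 1) (0, -(i + j : ℤ)) _ (hX _ _ (by simp [jetWeight])) ?_
        (by simp [jetWeight]; ring)
      refine ((hX _ _ (by simp [jetWeight]; ring)).sub ?_).sub ?_
      · exact hmul _ _ 0 _ _ (hX _ _ (by simp [jetWeight])) (hX _ _ rfl)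
          (by simp [jetWeight]; ring)
      · exact hmul _ _ _ _ _ (hX _ _ rfl) hR (by simp [jetWeight]; ring)
  induction n with
  | zero => exact hX _ _ (by simp [jetWeight])
  | succ n ih =>
    rw [genPoly]
    refine IsWeightedHomogeneous.sub ?_ ?_
    · have h := ih.derivation formalD hD
      rwa [show (((n : ℤ) + 1, 1) + (1, 0) : ℤ × ℤ) = (((n + 1 : ℕ) : ℤ) + 1, 1) by simp] at h
    · refine hmul _ _ (1, 0) _ _ ?_ ih (by simp; ring)
      exact hmul _ _ (1, 1) _ _ (hX _ _ (by simp [jetWeight])) hR (by simp)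

theorem genPoly_mem_supported (n : ℕ) : genPoly (n + 1) ∈ supported ℤ jetVars := by
  have hX : ∀ v ∈ jetVars, (X v : MvPolynomial (ℕ ⊕ ℕ × ℕ) ℤ) ∈ supported ℤ jetVars :=
    fun v hv => Algebra.subset_adjoin ⟨v, hv, rfl⟩
  have hR : (X (Sum.inr (1, 1)) - X (Sum.inr (0, 1)) * X (Sum.inr (2, 0)) :
      MvPolynomial (ℕ ⊕ ℕ × ℕ) ℤ) ∈ supported ℤ jetVars :=
    sub_mem (hX _ (by simp [jetVars]))
      (mul_mem (hX _ (by simp [jetVars])) (hX _ (by simp [jetVars])))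
  have hD : ∀ v ∈ jetVars, formalD (X v) ∈ supported ℤ jetVars := by
    rintro (k | ⟨i, j⟩) hv
    · rw [formalD_inl]
      exact hX _ (by simp [jetVars])
    · rw [formalD_inr]
      have hij : 1 ≤ i + j := by
        simp only [jetVars, Set.mem_ofPred_eq, Sum.elim_inr, Prod.mk.injEq] at hv
        omega
      refine mul_mem (hX _ (by simp [jetVars])) (sub_mem (sub_mem (hX _ ?_)
        (mul_mem (hX _ (by simp [jetVars])) (hX _ ?_))) (mul_mem (hX _ hv) hR)) <;>
      · simp only [jetVars, Set.mem_ofPred_eq, Sum.elim_inr, Prod.mk.injEq]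
        omega
  induction n with
  | zero => exact hX _ (by simp [jetVars])
  | succ n ih =>
    rw [genPoly]
    exact sub_mem (derivation_mem_supported formalD hD ih)
      (mul_mem (mul_mem (hX _ (by simp [jetVars])) hR) ih)

/-- The only term of the canonical polynomial which is linear in the jets is `y^(n)`: the other
terms lie in the square of the ideal generated by the jets. -/
theorem genPoly_sub_mem (n : ℕ) : genPoly (n + 1) - X (Sum.inl (n + 1)) ∈
    (Ideal.span (Set.range fun k => (X (Sum.inl k) : MvPolynomial (ℕ ⊕ ℕ × ℕ) ℤ))) ^ 2 := by
  have hX : ∀ k, (X (Sum.inl k) : MvPolynomial (ℕ ⊕ ℕ × ℕ) ℤ) ∈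
      Ideal.span (Set.range fun k => (X (Sum.inl k) : MvPolynomial (ℕ ⊕ ℕ × ℕ) ℤ)) :=
    fun k => Ideal.subset_span ⟨k, rfl⟩
  induction n with
  | zero => simp [genPoly]
  | succ n ih =>
    have h1 := derivation_mem_sq formalD (by
      rintro _ ⟨k, rfl⟩
      simp only [formalD_inl]
      exact hX _) ih
    rw [map_sub, formalD_inl] at h1
    have h2 := add_mem (Ideal.pow_le_self two_ne_zero ih) (hX (n + 1))
    rw [sub_add_cancel] at h2
    rw [genPoly, sub_right_comm]
    refine sub_mem h1 ?_
    rw [sq]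
    exact Ideal.mul_mem_mul (Ideal.mul_mem_right _ _ (hX 1)) h2

theorem coeff_single_sumAlgEquiv_genPoly (n : ℕ) :
    coeff (Finsupp.single (n + 1) 1) (sumAlgEquiv ℤ ℕ (ℕ × ℕ) (genPoly (n + 1))) = 1 := by
  have h : Ideal.span (Set.range fun k => (X (Sum.inl k) : MvPolynomial (ℕ ⊕ ℕ × ℕ) ℤ)) ≤
      (idealOfVars ℕ (MvPolynomial (ℕ × ℕ) ℤ)).comap (sumAlgEquiv ℤ ℕ (ℕ × ℕ)) := by
    rw [Ideal.span_le]
    rintro _ ⟨k, rfl⟩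
    simp only [SetLike.mem_coe, Ideal.mem_comap, sumAlgEquiv_X_inl]
    exact Ideal.subset_span ⟨k, rfl⟩
  have h2 := Ideal.le_comap_pow _ 2 (Ideal.pow_right_mono h 2 (genPoly_sub_mem n))
  rw [Ideal.mem_comap, mem_pow_idealOfVars_iff', map_sub, sumAlgEquiv_X_inl] at h2
  have h3 := h2 (Finsupp.single (n + 1) 1) (by simp)
  rw [coeff_sub, coeff_X, sub_eq_zero] at h3
  simpa using h3

/-- The exponents `m` of the jets and `e` of the quotients `r_{i,j}` in a monomial of `genPoly n`:
a translation of the bihomogeneity of `genPoly n` into equations between natural numbers. The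
truncated subtraction is harmless since `(0, 0)` is not in the support of `e`. -/
theorem genPoly_exponents {n : ℕ} (hn : 1 ≤ n) {m : ℕ →₀ ℕ} {e : ℕ × ℕ →₀ ℕ}
    (h : coeff e (coeff m (sumAlgEquiv ℤ ℕ (ℕ × ℕ) (genPoly n))) ≠ 0) :
    m 0 = 0 ∧ (m.sum fun k c => c * k) = n ∧
      (∀ s ∈ e.support, s = (0, 1) ∨ 2 ≤ s.1 + s.2) ∧
      (e.sum fun s h => h * (s.1 + s.2 - 1)) + 1 = m.sum fun _ c => c := by
  obtain ⟨n, rfl⟩ := Nat.exists_eq_add_of_le' hn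
  rw [coeff_coeff_sumAlgEquiv] at h
  have hw := genPoly_isWeightedHomogeneous n h
  have hv : ∀ v, Finsupp.sumElim m e v ≠ 0 → v ∈ jetVars := fun v hv =>
    (mem_supported.mp (genPoly_mem_supported n)) ((mem_vars_iff_mem_support v).mpr
      ⟨_, mem_support_iff.mpr h, Finsupp.mem_support_iff.mpr hv⟩)
  have h0 : m 0 = 0 := by
    by_contra h0
    simpa [jetVars] using hv (Sum.inl 0) h0
  have hs : ∀ s ∈ e.support, s = (0, 1) ∨ 2 ≤ s.1 + s.2 := fun s hs => by
    simpa [jetVars] using hv (Sum.inr s) (by simpa using hs)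
  have hsplit : Finsupp.sumElim m e = m.mapDomain Sum.inl + e.mapDomain Sum.inr := by
    ext (i | i)
    · simp [Finsupp.mapDomain_apply Sum.inl_injective, Finsupp.mapDomain_of_notMem_range]
    · simp [Finsupp.mapDomain_apply Sum.inr_injective, Finsupp.mapDomain_of_notMem_range]
  rw [hsplit, map_add, Finsupp.weight_apply, Finsupp.weight_apply,
    Finsupp.sum_mapDomain_index (by simp) (by intros; rw [add_smul]),
    Finsupp.sum_mapDomain_index (by simp) (by intros; rw [add_smul])] at hw
  have hw1 := congrArg Prod.fst hw
  have hw2 := congrArg Prod.snd hw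
  simp only [jetWeight, Sum.elim_inl, Sum.elim_inr, Finsupp.sum, Prod.fst_add, Prod.snd_add,
    Prod.fst_sum, Prod.snd_sum, Prod.smul_fst, Prod.smul_snd, smul_zero,
    Finset.sum_const_zero, add_zero] at hw1 hw2
  simp only [nsmul_eq_mul, mul_one] at hw1 hw2
  refine ⟨h0, ?_, hs, ?_⟩
  · simp only [Finsupp.sum]
    exact_mod_cast hw1
  · simp only [Finsupp.sum]
    have key : ∑ s ∈ e.support, (e s : ℤ) * ((s.1 + s.2 - 1 : ℕ) : ℤ) =
        -∑ s ∈ e.support, (e s : ℤ) * (1 - ((s.1 : ℤ) + s.2)) := by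
      rw [← Finset.sum_neg_distrib]
      refine Finset.sum_congr rfl fun s h => ?_
      have : 1 ≤ s.1 + s.2 := by
        rcases hs s h with rfl | h <;> omega
      push_cast [this]
      ring
    have : ((∑ s ∈ e.support, e s * (s.1 + s.2 - 1) + 1 : ℕ) : ℤ) =
        ((∑ k ∈ m.support, m k : ℕ) : ℤ) := by
      push_cast only [Nat.cast_add, Nat.cast_sum, Nat.cast_mul, Nat.cast_one]
      rw [key]
      linarith
    exact_mod_cast this

/-! ### Partial derivatives along a curve -/

theorem MvPolynomial.pderiv_pderiv_comm {σ : Type*} (i j : σ) (p : MvPolynomial σ ℂ) :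
    pderiv i (pderiv j p) = pderiv j (pderiv i p) := by
  classical
  have h : ⁅pderiv (R := ℂ) i, pderiv (R := ℂ) j⁆ = 0 := by
    refine derivation_ext fun k => ?_
    simp [Derivation.commutator_apply, pderiv_X, Pi.single_apply, apply_ite]
  have := congrArg (fun D => D p) h
  simpa [Derivation.commutator_apply, sub_eq_zero] using this

theorem partialDeriv_pderiv_zero (R : MvPolynomial (Fin 2) ℂ) (i j : ℕ) (x y : ℂ) :
    eval ![x, y] (pderiv 0 ((pderiv 0)^[i] ((pderiv 1)^[j] R))) = partialDeriv R (i + 1) j x y := by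
  rw [partialDeriv, Function.iterate_succ_apply']

theorem partialDeriv_pderiv_one (R : MvPolynomial (Fin 2) ℂ) (i j : ℕ) (x y : ℂ) :
    eval ![x, y] (pderiv 1 ((pderiv 0)^[i] ((pderiv 1)^[j] R))) = partialDeriv R i (j + 1) x y := by
  have h : Function.Commute (pderiv (R := ℂ) (0 : Fin 2)) (pderiv (R := ℂ) (1 : Fin 2)) :=
    fun p => pderiv_pderiv_comm 0 1 p
  rw [partialDeriv, Function.iterate_succ_apply', (h.iterate_left i).eq]

theorem hasDerivAt_eval_pair (P : MvPolynomial (Fin 2) ℂ) {x y : ℂ → ℂ} {x' y' z : ℂ}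
    (hx : HasDerivAt x x' z) (hy : HasDerivAt y y' z) :
    HasDerivAt (fun w => eval ![x w, y w] P)
      (eval ![x z, y z] (pderiv 0 P) * x' + eval ![x z, y z] (pderiv 1 P) * y') z := by
  induction P using MvPolynomial.induction_on with
  | C a => simpa using hasDerivAt_const z a
  | add p q hp hq =>
    simp only [map_add]
    exact (hp.fun_add hq).congr_deriv (by ring)
  | mul_X p i hp =>
    simp only [map_mul, eval_X]
    fin_cases i
    · refine (hp.fun_mul hx).congr_deriv ?_
      simp [Derivation.leibniz, pderiv_X]
      ring
    · refine (hp.fun_mul hy).congr_deriv ?_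
      simp [Derivation.leibniz, pderiv_X]
      ring

theorem hasDerivAt_partialDeriv (R : MvPolynomial (Fin 2) ℂ) (i j : ℕ) {x y : ℂ → ℂ} {x' y' z : ℂ}
    (hx : HasDerivAt x x' z) (hy : HasDerivAt y y' z) :
    HasDerivAt (fun w => partialDeriv R i j (x w) (y w))
      (partialDeriv R (i + 1) j (x z) (y z) * x' + partialDeriv R i (j + 1) (x z) (y z) * y') z := by
  have h := hasDerivAt_eval_pair ((pderiv 0)^[i] ((pderiv 1)^[j] R)) hx hy
  rwa [partialDeriv_pderiv_zero, partialDeriv_pderiv_one] at h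

theorem partialDeriv_rename_swap (R : MvPolynomial (Fin 2) ℂ) (i j : ℕ) (x y : ℂ) :
    partialDeriv (rename (Equiv.swap 0 1) R) i j y x = partialDeriv R j i x y := by
  have hinj : Function.Injective (Equiv.swap (0 : Fin 2) 1) := (Equiv.swap 0 1).injective
  have h0 : ∀ P : MvPolynomial (Fin 2) ℂ, ∀ k, (pderiv 0)^[k] (rename (Equiv.swap 0 1) P) =
      rename (Equiv.swap 0 1) ((pderiv 1)^[k] P) := by
    intro P k
    refine (Function.Semiconj.iterate_right (f := rename (Equiv.swap (0 : Fin 2) 1)) ?_ k P).symm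
    intro Q
    simpa using (pderiv_rename hinj 1 Q).symm
  have h1 : ∀ P : MvPolynomial (Fin 2) ℂ, ∀ k, (pderiv 1)^[k] (rename (Equiv.swap 0 1) P) =
      rename (Equiv.swap 0 1) ((pderiv 0)^[k] P) := by
    intro P k
    refine (Function.Semiconj.iterate_right (f := rename (Equiv.swap (0 : Fin 2) 1)) ?_ k P).symm
    intro Q
    simpa using (pderiv_rename hinj 0 Q).symm
  have h : Function.Commute (pderiv (R := ℂ) (0 : Fin 2)) (pderiv (R := ℂ) (1 : Fin 2)) :=
    fun p => pderiv_pderiv_comm 0 1 p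
  have hv : ![y, x] ∘ (Equiv.swap (0 : Fin 2) 1) = ![x, y] := by
    ext k
    fin_cases k <;> simp
  rw [partialDeriv, partialDeriv, h1, h0, eval_rename, hv, ((h.iterate_left j).iterate_right i).eq]

/-- The expression in the jets of `x` is, up to sign, the expression in the jets of `y` for the curve
with `x` and `y` exchanged. -/
theorem xSide_eq_neg_ySide (J : JetFamily) (n : ℕ) (R : MvPolynomial (Fin 2) ℂ) (x y : ℂ → ℂ) :
    xSide J n R x y = -ySide J n (rename (Equiv.swap 0 1) R) y x := by
  simp only [xSide, ySide, partialDeriv_rename_swap]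

theorem eval_rename_swap (R : MvPolynomial (Fin 2) ℂ) (x y : ℂ) :
    eval ![y, x] (rename (Equiv.swap 0 1) R) = eval ![x, y] R :=
  partialDeriv_rename_swap R 0 0 x y

/-! ### The canonical family is generating -/

/-- Exponents `m` of jets of total weight `n`, without undifferentiated jet, are the multiplicities
of the parts of a partition of `n`. -/
theorem Nat.Partition.exists_toFinsupp_eq {n : ℕ} {m : ℕ →₀ ℕ} (h0 : m 0 = 0)
    (hm : (m.sum fun k c => c * k) = n) : ∃ p : Nat.Partition n, Multiset.toFinsupp p.parts = m := by
  obtain ⟨s, rfl⟩ : ∃ s : Multiset ℕ, Multiset.toFinsupp s = m :=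
    ⟨_, Finsupp.toMultiset_toFinsupp m⟩
  rw [Multiset.toFinsupp_apply, Multiset.count_eq_zero] at h0
  refine ⟨⟨s, fun hi => Nat.pos_of_ne_zero fun h => h0 (h ▸ hi), ?_⟩, rfl⟩
  rw [← hm, Finset.sum_multiset_count]
  rfl

/-- For the canonical family, `sideExpr` reassembles `genPoly n` from its coefficients. The only
partition of `n` left out by the condition on the parts is the one with one part, whose coefficient
is `1`: it gives the leading term `z n / D`. -/
theorem sideExpr_canonicalFamily {n : ℕ} (hn : 1 ≤ n) (D : ℂ) (r : ℕ × ℕ → ℂ) (z : ℕ → ℂ) :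
    sideExpr canonicalFamily n D r z = aeval (Sum.elim z r) (genPoly n) / D := by
  classical
  have hterm : ∀ p : Nat.Partition n,
      (∏ i ∈ (Multiset.toFinsupp p.parts).support, z i ^ (Multiset.toFinsupp p.parts) i) =
        (p.parts.map z).prod := fun p => by
    rw [Finset.prod_multiset_map_count, Multiset.toFinsupp_support]
    rfl
  have hsum : aeval (Sum.elim z r) (genPoly n) =
      ∑ p : Nat.Partition n, (p.parts.map z).prod * aeval r (canonicalFamily n p) := by
    rw [aeval_sumElim_eq_sum]
    have hinj : Function.Injective fun p : Nat.Partition n => Multiset.toFinsupp p.parts :=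
      fun p q h => Nat.Partition.ext (Multiset.toFinsupp.injective h)
    have hsub : (sumAlgEquiv ℤ ℕ (ℕ × ℕ) (genPoly n)).support ⊆
        (Finset.univ : Finset (Nat.Partition n)).image
          fun p => Multiset.toFinsupp p.parts := by
      intro m hm
      obtain ⟨e, he⟩ := ne_zero_iff.mp (mem_support_iff.mp hm)
      obtain ⟨h0, h1, -⟩ := genPoly_exponents hn he
      obtain ⟨p, hp⟩ := Nat.Partition.exists_toFinsupp_eq h0 h1
      exact Finset.mem_image.mpr ⟨p, Finset.mem_univ _, hp⟩
    rw [Finset.sum_subset hsub, Finset.sum_image fun p _ q _ h => hinj h]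
    · exact Finset.sum_congr rfl fun p _ => by rw [hterm]; rfl
    · intro m _ hm
      rw [notMem_support_iff.mp hm, map_zero, mul_zero]
  have hone : aeval r (canonicalFamily n (Nat.Partition.indiscrete n)) = 1 := by
    obtain ⟨n, rfl⟩ := Nat.exists_eq_add_of_le' hn
    rw [canonicalFamily, Nat.Partition.indiscrete_parts (by omega), Multiset.toFinsupp_singleton,
      coeff_single_sumAlgEquiv_genPoly, map_one]
  have hfilter : (Finset.univ.filter fun p : Nat.Partition n => ¬ ∀ j ∈ p.parts, j < n) =
      {Nat.Partition.indiscrete n} := by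
    ext p
    simp only [Finset.mem_filter_univ, Finset.mem_singleton, not_forall, not_lt, exists_prop]
    constructor
    · rintro ⟨j, hj, hnj⟩
      obtain rfl : j = n := le_antisymm (p.le_of_mem_parts hj) hnj
      refine Nat.Partition.ext ?_
      rw [Nat.Partition.indiscrete_parts (by omega)]
      obtain ⟨t, ht⟩ := Multiset.exists_cons_of_mem hj
      have h1 := p.parts_sum
      rw [ht, Multiset.sum_cons] at h1
      have h2 : t = 0 := Multiset.eq_zero_of_forall_notMem fun i hi => by
        have := Multiset.le_sum_of_mem hi
        have := p.parts_pos (i := i) (by rw [ht]; exact Multiset.mem_cons_of_mem hi)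
        omega
      rw [ht, h2]
      rfl
    · rintro rfl
      exact ⟨n, by rw [Nat.Partition.indiscrete_parts (by omega)]; simp, le_rfl⟩
  rw [hsum, ← Finset.sum_filter_add_sum_filter_not Finset.univ (fun p => ∀ j ∈ p.parts, j < n),
    hfilter, Finset.sum_singleton, hone, Nat.Partition.indiscrete_parts (by omega), sideExpr,
    add_comm, add_div, Finset.sum_div]
  simp only [Multiset.map_singleton, Multiset.prod_singleton, mul_one, div_mul_eq_mul_div]

/-- Along a curve, the canonical polynomials compute the successive derivatives of `y' / R_x`. -/
theorem aeval_genPoly_div (R : MvPolynomial (Fin 2) ℂ) {x y : ℂ → ℂ} {z : ℂ}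
    (hx : AnalyticAt ℂ x z) (hy : AnalyticAt ℂ y z)
    (hR : ∀ᶠ w in 𝓝 z, eval ![x w, y w] R = 0) (h0 : partialDeriv R 1 0 (x z) (y z) ≠ 0) (n : ℕ) :
    aeval (Sum.elim (fun k => iteratedDeriv k y z)
        fun s => partialDeriv R s.1 s.2 (x z) (y z) / partialDeriv R 1 0 (x z) (y z))
      (genPoly (n + 1)) / partialDeriv R 1 0 (x z) (y z) =
    iteratedDeriv n (fun w => deriv y w / partialDeriv R 1 0 (x w) (y w)) z := by
  induction n generalizing z with
  | zero => simp [genPoly]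
  | succ n ih =>
    have hP : ∀ i j, HasDerivAt (fun w => partialDeriv R i j (x w) (y w))
        (partialDeriv R (i + 1) j (x z) (y z) * deriv x z +
          partialDeriv R i (j + 1) (x z) (y z) * deriv y z) z := fun i j =>
      hasDerivAt_partialDeriv R i j hx.differentiableAt.hasDerivAt hy.differentiableAt.hasDerivAt
    -- Near `z` the formula for the derivative of order `n` is available, and can be differentiated.
    have hev : (fun w => aeval (Sum.elim (fun k => iteratedDeriv k y w)
        fun s => partialDeriv R s.1 s.2 (x w) (y w) / partialDeriv R 1 0 (x w) (y w))
          (genPoly (n + 1)) / partialDeriv R 1 0 (x w) (y w)) =ᶠ[𝓝 z]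
        iteratedDeriv n (fun w => deriv y w / partialDeriv R 1 0 (x w) (y w)) := by
      filter_upwards [hx.eventually_analyticAt, hy.eventually_analyticAt,
        eventually_eventually_nhds.mpr hR, (hP 1 0).continuousAt.eventually_ne h0] with
        w h1 h2 h3 h4 using ih h1 h2 h3 h4
    rw [iteratedDeriv_succ, ← hev.deriv_eq]
    -- The derivative of `R(x, y) = 0` justifies the replacement of `x'` by `-y' R_y / R_x`.
    have hx' : deriv x z =
        -(deriv y z * (partialDeriv R 0 1 (x z) (y z) / partialDeriv R 1 0 (x z) (y z))) := by
      have h1 := (hP 0 0).congr_of_eventuallyEq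
        (f₁ := fun _ => 0) (hR.mono fun w hw => hw.symm)
      have h2 := h1.unique (hasDerivAt_const z (0 : ℂ))
      field_simp
      linear_combination h2
    have hD := hasDerivAt_aeval formalD
      (fun w => Sum.elim (fun k => iteratedDeriv k y w)
        fun s => partialDeriv R s.1 s.2 (x w) (y w) / partialDeriv R 1 0 (x w) (y w)) z (by
      rintro (k | ⟨i, j⟩)
      · rw [formalD_inl, aeval_X]
        simp only [Sum.elim_inl, iteratedDeriv_succ]
        rw [iteratedDeriv_eq_iterate]
        exact (hy.iterated_deriv k).differentiableAt.hasDerivAt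
      · rw [formalD_inr]
        simp only [Sum.elim_inr]
        refine ((hP i j).div (hP 1 0) h0).congr_deriv ?_
        simp only [map_mul, map_sub, aeval_X, Sum.elim_inl, Sum.elim_inr, iteratedDeriv_one, hx']
        field_simp
        ring) (genPoly (n + 1))
    rw [(hD.fun_div (hP 1 0) h0).deriv, genPoly]
    simp only [map_mul, map_sub, aeval_X, Sum.elim_inl, Sum.elim_inr, iteratedDeriv_one, hx']
    field_simp
    ring

theorem ySide_canonicalFamily (R : MvPolynomial (Fin 2) ℂ) {x y : ℂ → ℂ}
    (hx : AnalyticAt ℂ x 0) (hy : AnalyticAt ℂ y 0)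
    (hR : ∀ᶠ w in 𝓝 0, eval ![x w, y w] R = 0) (h0 : partialDeriv R 1 0 (x 0) (y 0) ≠ 0) (n : ℕ) :
    ySide canonicalFamily (n + 1) R x y =
      iteratedDeriv n (fun w => deriv y w / partialDeriv R 1 0 (x w) (y w)) 0 := by
  rw [ySide, sideExpr_canonicalFamily (by omega), aeval_genPoly_div R hx hy hR h0]

theorem isGeneratingFamily_canonicalFamily : IsGeneratingFamily canonicalFamily where
  vars_mem n hn p hp s hs := by
    classical
    obtain ⟨e, he, hse⟩ := (mem_vars_iff_mem_support s).mp hs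
    obtain ⟨-, -, h1, h2⟩ := genPoly_exponents hn (mem_support_iff.mp he)
    refine (h1 s hse).imp_right fun h => ⟨h, ?_⟩
    have h3 : e s * (s.1 + s.2 - 1) ≤ e.sum fun s h => h * (s.1 + s.2 - 1) :=
      Finset.single_le_sum (f := fun s => e s * (s.1 + s.2 - 1)) (fun _ _ => Nat.zero_le _) hse
    have h4 : 1 * (s.1 + s.2 - 1) ≤ e s * (s.1 + s.2 - 1) :=
      Nat.mul_le_mul_right _ (Nat.one_le_iff_ne_zero.mpr (Finsupp.mem_support_iff.mp hse))
    have h5 := Multiset.toFinsupp_sum_eq p.parts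
    change ((Multiset.toFinsupp p.parts).sum fun _ c => c) = _ at h5
    omega
  weight_eq n hn p hp e he := by
    classical
    obtain ⟨-, -, -, h2⟩ := genPoly_exponents hn (mem_support_iff.mp he)
    have h5 := Multiset.toFinsupp_sum_eq p.parts
    change ((Multiset.toFinsupp p.parts).sum fun _ c => c) = _ at h5
    omega
  symmetric_eq n hn R x y hx hy hR h1 h2 := by
    obtain ⟨n, rfl⟩ := Nat.exists_eq_add_of_le' hn
    rw [xSide_eq_neg_ySide, ySide_canonicalFamily R hx hy hR h1, ySide_canonicalFamily _ hy hx
      (by simpa only [eval_rename_swap] using hR) (by rwa [partialDeriv_rename_swap]),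
      ← iteratedDeriv_fun_neg]
    refine Filter.EventuallyEq.iteratedDeriv_eq n ?_
    have hc : ∀ i j, ContinuousAt (fun w => partialDeriv R i j (x w) (y w)) 0 := fun i j =>
      (hasDerivAt_partialDeriv R i j hx.differentiableAt.hasDerivAt
        hy.differentiableAt.hasDerivAt).continuousAt
    filter_upwards [hx.eventually_analyticAt, hy.eventually_analyticAt,
      eventually_eventually_nhds.mpr hR, (hc 1 0).eventually_ne h1, (hc 0 1).eventually_ne h2]
      with w hxw hyw hRw h1w h2w
    rw [partialDeriv_rename_swap]
    have h3 := (hasDerivAt_partialDeriv R 0 0 hxw.differentiableAt.hasDerivAt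
      hyw.differentiableAt.hasDerivAt).congr_of_eventuallyEq
        (f₁ := fun _ => 0) (hRw.mono fun w hw => hw.symm)
    have h4 := h3.unique (hasDerivAt_const w (0 : ℂ))
    field_simp
    linear_combination h4

/-! ### Filtrations of functions by their order at a point -/

/-- A decreasing multiplicative filtration of the functions near a point of `ℂ` by additive
submonoids `C k`, to be thought of as the functions of order at least `k` at the point. -/
structure IsOrderFiltration (C : ℤ → AddSubmonoid (ℂ → ℂ)) : Prop where
  anti : ∀ {k l : ℤ}, k ≤ l → C l ≤ C k
  mul_mem : ∀ {k l : ℤ} {f g : ℂ → ℂ}, f ∈ C k → g ∈ C l → f * g ∈ C (k + l)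
  const_mem : ∀ c : ℂ, Function.const ℂ c ∈ C 0

namespace IsOrderFiltration

variable {C : ℤ → AddSubmonoid (ℂ → ℂ)}

theorem pow_mem (hC : IsOrderFiltration C) {k : ℤ} {f : ℂ → ℂ} (hf : f ∈ C k) (n : ℕ) :
    f ^ n ∈ C (n * k) := by
  induction n with
  | zero => simpa [Function.const_one] using hC.const_mem 1
  | succ n ih =>
    rw [pow_succ, show ((n + 1 : ℕ) : ℤ) * k = n * k + k by push_cast; ring]
    exact hC.mul_mem ih hf

theorem prod_pow_mem (hC : IsOrderFiltration C) {ι : Type*} (s : Finset ι) (f : ι → ℂ → ℂ)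
    (w : ι → ℤ) (e : ι → ℕ) (hf : ∀ i ∈ s, f i ∈ C (w i)) :
    ∏ i ∈ s, f i ^ e i ∈ C (∑ i ∈ s, e i * w i) := by
  classical
  induction s using Finset.induction_on with
  | empty => simpa [Function.const_one] using hC.const_mem 1
  | insert i s hi ih =>
    rw [Finset.prod_insert hi, Finset.sum_insert hi]
    exact hC.mul_mem (hC.pow_mem (hf i (Finset.mem_insert_self i s)) _)
      (ih fun j hj => hf j (Finset.mem_insert_of_mem hj))

/-- An isobaric polynomial in functions of given orders. -/
theorem aeval_mem (hC : IsOrderFiltration C) {σ : Type*} (r : ℂ → σ → ℂ) (w : σ → ℤ)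
    (P : MvPolynomial σ ℤ) (k : ℤ) (hr : ∀ s ∈ P.vars, (fun t => r t s) ∈ C (w s))
    (hP : ∀ e ∈ P.support, (e.sum fun s h => (h : ℤ) * w s) = k) :
    (fun t => MvPolynomial.aeval (r t) P) ∈ C k := by
  classical
  have h : (fun t => MvPolynomial.aeval (r t) P) =
      ∑ e ∈ P.support, Function.const ℂ ((MvPolynomial.coeff e P : ℤ) : ℂ) * ∏ s ∈ e.support, (fun t => r t s) ^ e s := by
    ext t
    rw [MvPolynomial.aeval_def, MvPolynomial.eval₂_eq]
    simp [Finset.sum_apply, Finset.prod_apply]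
  rw [h]
  refine sum_mem fun e he => ?_
  have h2 := hC.mul_mem (hC.const_mem ((MvPolynomial.coeff e P : ℤ) : ℂ)) (hC.prod_pow_mem e.support
    (fun s t => r t s) w e fun s hs => hr s ((MvPolynomial.mem_vars_iff_mem_support s).mpr
      ⟨e, he, hs⟩))
  rwa [zero_add, show ∑ s ∈ e.support, (e s : ℤ) * w s = k from hP e he] at h2

end IsOrderFiltration

/-- The functions which are holomorphic at `t₀`. -/
def analyticFunctions (t₀ : ℂ) : AddSubmonoid (ℂ → ℂ) where
  carrier := {f | AnalyticAt ℂ f t₀}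
  add_mem' hf hg := hf.add hg
  zero_mem' := analyticAt_const

/-- The functions which are meromorphic of order at least `k` at `t₀`. Their value at `t₀` is
arbitrary. -/
def functionsOfOrder (t₀ : ℂ) (k : ℤ) : AddSubmonoid (ℂ → ℂ) where
  carrier := {f | ∃ h, AnalyticAt ℂ h t₀ ∧ ∀ᶠ t in 𝓝[≠] t₀, f t = (t - t₀) ^ k * h t}
  add_mem' := by
    rintro f g ⟨u, hu, hfu⟩ ⟨v, hv, hgv⟩
    refine ⟨u + v, hu.add hv, ?_⟩
    filter_upwards [hfu, hgv] with t h1 h2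
    rw [Pi.add_apply, h1, h2, Pi.add_apply, mul_add]
  zero_mem' := ⟨0, analyticAt_const, by simp⟩

theorem mem_functionsOfOrder {t₀ : ℂ} {k : ℤ} {f : ℂ → ℂ} : f ∈ functionsOfOrder t₀ k ↔
    ∃ h, AnalyticAt ℂ h t₀ ∧ ∀ᶠ t in 𝓝[≠] t₀, f t = (t - t₀) ^ k * h t :=
  Iff.rfl

theorem isOrderFiltration_analyticFunctions (t₀ : ℂ) :
    IsOrderFiltration fun _ => analyticFunctions t₀ where
  anti _ := le_rfl
  mul_mem hf hg := AnalyticAt.mul hf hg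
  const_mem _ := analyticAt_const

theorem isOrderFiltration_functionsOfOrder (t₀ : ℂ) : IsOrderFiltration (functionsOfOrder t₀) where
  anti := by
    rintro k l hkl f ⟨u, hu, hfu⟩
    obtain ⟨n, rfl⟩ := Int.le.dest hkl
    refine mem_functionsOfOrder.mpr ⟨fun t => (t - t₀) ^ n * u t, by fun_prop, ?_⟩
    filter_upwards [hfu, self_mem_nhdsWithin] with t h1 h2
    rw [h1, zpow_add₀ (sub_ne_zero.mpr h2), zpow_natCast, mul_assoc]
  mul_mem := by
    rintro k l f g ⟨u, hu, hfu⟩ ⟨v, hv, hgv⟩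
    refine mem_functionsOfOrder.mpr ⟨u * v, hu.mul hv, ?_⟩
    filter_upwards [hfu, hgv, self_mem_nhdsWithin] with t h1 h2 h3
    rw [Pi.mul_apply, h1, h2, zpow_add₀ (sub_ne_zero.mpr h3), Pi.mul_apply]
    ring
  const_mem c := ⟨fun _ => c, analyticAt_const, by simp⟩

theorem deriv_mem_functionsOfOrder {t₀ : ℂ} {k : ℤ} {f : ℂ → ℂ} (hf : f ∈ functionsOfOrder t₀ k) :
    deriv f ∈ functionsOfOrder t₀ (k - 1) := by
  obtain ⟨u, hu, hfu⟩ := hf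
  refine mem_functionsOfOrder.mpr ⟨fun t => k * u t + (t - t₀) * deriv u t, ?_, ?_⟩
  · have := hu.deriv
    fun_prop
  · filter_upwards [eventually_eventually_nhdsWithin.mpr hfu, self_mem_nhdsWithin,
      hu.eventually_analyticAt.filter_mono nhdsWithin_le_nhds] with t h1 h2 h3
    have h2' : t - t₀ ≠ 0 := sub_ne_zero.mpr h2
    have h4 : f =ᶠ[𝓝 t] fun t => (t - t₀) ^ k * u t := by
      rwa [IsOpen.nhdsWithin_eq isOpen_compl_singleton h2] at h1
    have h5 := ((hasDerivAt_zpow k (t - t₀) (Or.inl h2')).comp t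
      ((hasDerivAt_id t).sub_const t₀)).mul h3.differentiableAt.hasDerivAt
    rw [h4.deriv_eq]
    refine h5.deriv.trans ?_
    simp only [Function.comp_apply, id_eq]
    rw [show (t - t₀) ^ k = (t - t₀) ^ (k - 1) * (t - t₀) by
      rw [← zpow_add_one₀ h2', sub_add_cancel]]
    ring

theorem iteratedDeriv_mem_functionsOfOrder {t₀ : ℂ} {k : ℤ} {f : ℂ → ℂ}
    (hf : f ∈ functionsOfOrder t₀ k) (n : ℕ) :
    iteratedDeriv n f ∈ functionsOfOrder t₀ (k - n) := by
  induction n with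
  | zero => simpa using hf
  | succ n ih =>
    rw [iteratedDeriv_succ, show k - ((n + 1 : ℕ) : ℤ) = k - n - 1 by push_cast; ring]
    exact deriv_mem_functionsOfOrder ih

theorem iteratedDeriv_mem_analyticFunctions {t₀ : ℂ} {f : ℂ → ℂ}
    (hf : f ∈ analyticFunctions t₀) (n : ℕ) : iteratedDeriv n f ∈ analyticFunctions t₀ := by
  rw [iteratedDeriv_eq_iterate]
  exact AnalyticAt.iterated_deriv hf n

/-! ### Isobaric polynomials in the jets of a germ -/

/-- The jet monomial `∏ g^(j)(0)`, the product over the parts `j` of the partition `p`. -/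
def jetMonomial {m : ℕ} (p : Nat.Partition m) (g : ℂ → ℂ) : ℂ :=
  (p.parts.map fun j => iteratedDeriv j g 0).prod

/-- For the germs `g` at `0` with `g 0` in a set of the filter `l`, `Φ g` is an isobaric polynomial
of weight `m` in the jets of `g`, with coefficients which are functions of `g 0` in `C`. -/
def IsJetPoly (l : Filter ℂ) (C : AddSubmonoid (ℂ → ℂ)) (m : ℕ) (Φ : (ℂ → ℂ) → ℂ) : Prop :=
  ∃ a : Nat.Partition m → ℂ → ℂ, (∀ p, a p ∈ C) ∧
    ∀ᶠ t in l, ∀ g : ℂ → ℂ, AnalyticAt ℂ g 0 → g 0 = t →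
      Φ g = ∑ p, a p (g 0) * jetMonomial p g

namespace IsJetPoly

variable {l : Filter ℂ} {C C₁ C₂ : AddSubmonoid (ℂ → ℂ)} {m m₁ m₂ : ℕ} {Φ Ψ : (ℂ → ℂ) → ℂ}

theorem congr (h : IsJetPoly l C m Φ)
    (hΨ : ∀ᶠ t in l, ∀ g : ℂ → ℂ, AnalyticAt ℂ g 0 → g 0 = t → Ψ g = Φ g) :
    IsJetPoly l C m Ψ := by
  obtain ⟨a, ha, h⟩ := h
  refine ⟨a, ha, ?_⟩
  filter_upwards [h, hΨ] with t h1 h2 g hg hgt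
  rw [h2 g hg hgt, h1 g hg hgt]

theorem zero : IsJetPoly l C m fun _ => 0 :=
  ⟨0, fun _ => zero_mem C, by simp⟩

theorem add (hΦ : IsJetPoly l C m Φ) (hΨ : IsJetPoly l C m Ψ) :
    IsJetPoly l C m fun g => Φ g + Ψ g := by
  obtain ⟨a, ha, h1⟩ := hΦ
  obtain ⟨b, hb, h2⟩ := hΨ
  refine ⟨a + b, fun p => add_mem (ha p) (hb p), ?_⟩
  filter_upwards [h1, h2] with t h1 h2 g hg hgt
  simp [h1 g hg hgt, h2 g hg hgt, add_mul, Finset.sum_add_distrib]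

theorem sum {ι : Type*} (s : Finset ι) (F : ι → (ℂ → ℂ) → ℂ) (h : ∀ i ∈ s, IsJetPoly l C m (F i)) :
    IsJetPoly l C m fun g => ∑ i ∈ s, F i g := by
  classical
  induction s using Finset.induction_on with
  | empty => simpa using zero
  | insert i s hi ih =>
    simp only [Finset.sum_insert hi]
    exact (h i (Finset.mem_insert_self i s)).add
      (ih fun j hj => h j (Finset.mem_insert_of_mem hj))

theorem single (p : Nat.Partition m) {a : ℂ → ℂ} (ha : a ∈ C) :
    IsJetPoly l C m fun g => a (g 0) * jetMonomial p g := by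
  classical
  refine ⟨Pi.single p a, fun q => ?_, Eventually.of_forall fun t g _ _ => ?_⟩
  · rcases eq_or_ne q p with rfl | h
    · simpa using ha
    · simp [Pi.single_eq_of_ne h]
  · rw [Finset.sum_eq_single p]
    · simp
    · intro q _ h
      simp [Pi.single_eq_of_ne h]
    · simp

theorem mul (hΦ : IsJetPoly l C₁ m₁ Φ) (hΨ : IsJetPoly l C₂ m₂ Ψ)
    (hC : ∀ f ∈ C₁, ∀ g ∈ C₂, f * g ∈ C) : IsJetPoly l C (m₁ + m₂) fun g => Φ g * Ψ g := by
  obtain ⟨a, ha, h1⟩ := hΦ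
  obtain ⟨b, hb, h2⟩ := hΨ
  let q (pq : Nat.Partition m₁ × Nat.Partition m₂) : Nat.Partition (m₁ + m₂) :=
    ⟨pq.1.parts + pq.2.parts,
      fun hi => (Multiset.mem_add.mp hi).elim (pq.1.parts_pos ·) (pq.2.parts_pos ·),
      by simp [pq.1.parts_sum, pq.2.parts_sum]⟩
  have h : IsJetPoly l C (m₁ + m₂) fun g =>
      ∑ pq, (a pq.1 * b pq.2) (g 0) * jetMonomial (q pq) g :=
    sum _ _ fun pq _ => single (q pq) (hC _ (ha pq.1) _ (hb pq.2))
  refine h.congr ?_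
  filter_upwards [h1, h2] with t h1 h2 g hg hgt
  rw [h1 g hg hgt, h2 g hg hgt, Finset.sum_mul_sum, ← Finset.univ_product_univ,
    Finset.sum_product]
  refine Finset.sum_congr rfl fun p _ => Finset.sum_congr rfl fun p' _ => ?_
  simp only [jetMonomial, q, Multiset.map_add, Multiset.prod_add, Pi.mul_apply]
  ring

theorem coeff_mul (hΦ : IsJetPoly l C₂ m Φ) {b : ℂ → ℂ} (hb : b ∈ C₁)
    (hC : ∀ f ∈ C₁, ∀ g ∈ C₂, f * g ∈ C) : IsJetPoly l C m fun g => b (g 0) * Φ g := by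
  obtain ⟨a, ha, h⟩ := hΦ
  refine ⟨fun p => b * a p, fun p => hC _ hb _ (ha p), ?_⟩
  filter_upwards [h] with t h g hg hgt
  rw [h g hg hgt, Finset.mul_sum]
  simp [mul_assoc]

theorem neg (hΦ : IsJetPoly l C m Φ) (hC : ∀ f ∈ C, -f ∈ C) : IsJetPoly l C m fun g => -Φ g := by
  obtain ⟨a, ha, h⟩ := hΦ
  refine ⟨fun p => -a p, fun p => hC _ (ha p), ?_⟩
  filter_upwards [h] with t h g hg hgt
  simp [h g hg hgt]

/-- Faà di Bruno's formula. -/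
theorem iteratedDeriv_comp {u : ℂ → ℂ} (hu : ∀ᶠ t in l, AnalyticAt ℂ u t) (n : ℕ)
    (hC : ∀ k ≤ n, iteratedDeriv k u ∈ C) :
    IsJetPoly l C n fun g => iteratedDeriv n (u ∘ g) 0 := by
  have hsum : ∀ c : OrderedFinpartition n, ∑ i, c.partSize i = n := fun c => by
    simpa using Fintype.card_congr c.equivSigma
  let q (c : OrderedFinpartition n) : Nat.Partition n :=
    ⟨Finset.univ.val.map c.partSize,
      fun hi => by
        obtain ⟨i, -, rfl⟩ := Multiset.mem_map.mp hi
        exact c.partSize_pos i,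
      hsum c⟩
  have h : IsJetPoly l C n fun g =>
      ∑ c, iteratedDeriv c.length u (g 0) * jetMonomial (q c) g :=
    sum _ _ fun c _ => single (q c) (hC _ c.length_le)
  refine h.congr ?_
  filter_upwards [hu] with t hu g hg hgt
  rw [iteratedDeriv_comp_eq_sum_orderedFinpartition (n := n) (by rw [hgt]; exact hu.contDiffAt)
    hg.contDiffAt le_rfl]
  refine Finset.sum_congr rfl fun c _ => ?_
  rw [jetMonomial, Multiset.map_map, ← Finset.prod_map_val]
  rfl

end IsJetPoly

/-- The key weight count. If `u` and its derivatives have poles of order at most `α + β k`, if the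
quotients `r_{i,j}` have order at least `α (i + j - 1)`, and `1 / D` has order at least `γ`, then
all the coefficients of the expression in the jets of `u ∘ g` have order at least `γ - α - β n`: for
a partition `p` with `|p|` parts, the product of the jets contributes `-α |p| - β n`, and the
polynomial `J n p` contributes `α (|p| - 1)` by the relation between its exponents. -/
theorem isJetPoly_sideExpr {l : Filter ℂ} {C : ℤ → AddSubmonoid (ℂ → ℂ)}
    (hC : IsOrderFiltration C) {α β γ : ℤ} (hβ : 0 ≤ β) {J : JetFamily} (hJ : IsGeneratingFamily J)
    {n : ℕ} (hn : 1 ≤ n) {u D : ℂ → ℂ} {r : ℂ → ℕ × ℕ → ℂ} (hu : ∀ᶠ t in l, AnalyticAt ℂ u t)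
    (hder : ∀ k : ℕ, iteratedDeriv k u ∈ C (-α - β * k))
    (hr : ∀ s : ℕ × ℕ, 1 ≤ s.1 + s.2 → s.1 + s.2 ≤ n →
      (fun t => r t s) ∈ C (α * ((s.1 : ℤ) + s.2 - 1)))
    (hD : (fun t => (D t)⁻¹) ∈ C γ) :
    IsJetPoly l (C (γ - α - β * n)) n fun g =>
      sideExpr J n (D (g 0)) (r (g 0)) fun k => iteratedDeriv k (u ∘ g) 0 := by
  have hcomp : ∀ k : ℕ, IsJetPoly l (C (-α - β * k)) k fun g => iteratedDeriv k (u ∘ g) 0 :=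
    fun k => IsJetPoly.iteratedDeriv_comp hu k fun j hj => by
      refine hC.anti ?_ (hder j)
      have : (j : ℤ) ≤ k := by exact_mod_cast hj
      have := mul_le_mul_of_nonneg_left this hβ
      linarith
  have hprod : ∀ s : Multiset ℕ, IsJetPoly l (C (-α * s.card - β * s.sum)) s.sum fun g =>
      (s.map fun k => iteratedDeriv k (u ∘ g) 0).prod := by
    intro s
    induction s using Multiset.induction_on with
    | empty =>
      have h := IsJetPoly.single (l := l) (C := C 0) (m := 0) default (hC.const_mem 1)
      simpa [jetMonomial] using h
    | cons k s ih =>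
      simp only [Multiset.map_cons, Multiset.prod_cons, Multiset.sum_cons, Multiset.card_cons]
      refine (hcomp k).mul ih fun f hf g hg => ?_
      have := hC.mul_mem hf hg
      convert this using 2
      push_cast
      ring
  have hterm : ∀ p : Nat.Partition n, (∀ j ∈ p.parts, j < n) →
      IsJetPoly l (C (γ - α - β * n)) n fun g =>
        (p.parts.map fun k => iteratedDeriv k (u ∘ g) 0).prod / D (g 0) *
          MvPolynomial.aeval (r (g 0)) (J n p) := by
    intro p hp
    have hpos : 1 ≤ p.parts.card := by
      rw [Nat.one_le_iff_ne_zero, Ne, Multiset.card_eq_zero]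
      intro h0
      have := p.parts_sum
      rw [h0, Multiset.sum_zero] at this
      omega
    have hcard : p.parts.card ≤ n := by
      have := Multiset.card_nsmul_le_sum (s := p.parts) (a := 1) fun x hx => p.parts_pos hx
      rwa [p.parts_sum, smul_eq_mul, mul_one] at this
    have hvars : ∀ s ∈ (J n p).vars, 1 ≤ s.1 + s.2 ∧ s.1 + s.2 ≤ n := by
      intro s hs
      rcases hJ.vars_mem n hn p hp s hs with rfl | h <;> omega
    have hcoeff : (fun t => MvPolynomial.aeval (r t) (J n p)) ∈ C (α * ((p.parts.card : ℤ) - 1)) := by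
      classical
      refine hC.aeval_mem r (fun s => α * ((s.1 : ℤ) + s.2 - 1)) _ _
        (fun s hs => hr s (hvars s hs).1 (hvars s hs).2) fun e he => ?_
      have h := hJ.weight_eq n hn p hp e he
      rw [← Nat.cast_one, ← Nat.cast_sub hpos, ← h, Finsupp.sum, Finsupp.sum, Nat.cast_sum,
        Finset.mul_sum]
      refine Finset.sum_congr rfl fun s hs => ?_
      rw [Nat.cast_mul, Nat.cast_sub
        (hvars s ((MvPolynomial.mem_vars_iff_mem_support s).mpr ⟨e, he, hs⟩)).1]
      push_cast
      ring
    have h := hprod p.parts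
    rw [p.parts_sum] at h
    have h2 := h.coeff_mul (hC.mul_mem hD hcoeff) (C := C (γ - α - β * n)) fun f hf g hg => by
      have := hC.mul_mem hf hg
      convert this using 2
      ring
    refine h2.congr (Eventually.of_forall fun t g _ _ => ?_)
    simp only [Pi.mul_apply]
    ring
  have hlin : IsJetPoly l (C (γ - α - β * n)) n fun g =>
      iteratedDeriv n (u ∘ g) 0 / D (g 0) := by
    have h2 := (hcomp n).coeff_mul hD (C := C (γ - α - β * n)) fun f hf g hg => by
      have := hC.mul_mem hf hg
      convert this using 2
      ring
    exact h2.congr (Eventually.of_forall fun t g _ _ => by rw [div_eq_inv_mul])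
  exact hlin.add (IsJetPoly.sum _ _ fun p hp => hterm p (Finset.mem_filter.mp hp).2)

/-- Germs with prescribed jets. -/
theorem exists_germ_of_jet (c : ℕ → ℂ) (m : ℕ) :
    ∃ g : ℂ → ℂ, AnalyticAt ℂ g 0 ∧ ∀ k ≤ m, iteratedDeriv k g 0 = c k := by
  let P : Polynomial ℂ := ∑ j ∈ Finset.range (m + 1), Polynomial.monomial j (c j / j.factorial)
  have h : ∀ k, iteratedDeriv k (fun z => P.eval z) =
      fun z => (Polynomial.derivative^[k] P).eval z := by
    intro k
    induction k with
    | zero => simp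
    | succ k ih =>
      rw [iteratedDeriv_succ, ih, Function.iterate_succ_apply']
      ext z
      exact Polynomial.deriv _
  refine ⟨fun z => P.eval z, AnalyticOnNhd.eval_polynomial P 0 (Set.mem_univ 0), fun k hk => ?_⟩
  have hf : (k.factorial : ℂ) ≠ 0 := Nat.cast_ne_zero.mpr k.factorial_ne_zero
  rw [h]
  dsimp only
  rw [← Polynomial.coeff_zero_eq_eval_zero, Polynomial.coeff_iterate_derivative, zero_add,
    Nat.descFactorial_self, Polynomial.finsetSum_coeff]
  simp only [Polynomial.coeff_monomial]
  rw [Finset.sum_ite_eq', if_pos (Finset.mem_range.mpr (by omega)), nsmul_eq_mul]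
  field_simp

/-- The jet monomials are linearly independent. -/
theorem eq_of_jetMonomial_sum_eq {m : ℕ} (t : ℂ) (a b : Nat.Partition m → ℂ)
    (h : ∀ g : ℂ → ℂ, AnalyticAt ℂ g 0 → g 0 = t →
      ∑ p, a p * jetMonomial p g = ∑ p, b p * jetMonomial p g) : a = b := by
  classical
  have hQ : (∑ p, MvPolynomial.monomial (Multiset.toFinsupp p.parts) (a p)) =
      ∑ p, MvPolynomial.monomial (Multiset.toFinsupp p.parts) (b p) := by
    refine MvPolynomial.funext fun c => ?_
    obtain ⟨g, hg, hgc⟩ := exists_germ_of_jet (Function.update c 0 t) m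
    have hmon : ∀ (p : Nat.Partition m) (x : ℂ),
        MvPolynomial.eval c (MvPolynomial.monomial (Multiset.toFinsupp p.parts) x) =
          x * jetMonomial p g := by
      intro p x
      have h1 : jetMonomial p g = (p.parts.map c).prod := by
        refine congrArg Multiset.prod (Multiset.map_congr rfl fun j hj => ?_)
        rw [hgc j (p.le_of_mem_parts hj), Function.update_of_ne (p.parts_pos hj).ne']
      rw [h1, MvPolynomial.eval_monomial, Finset.prod_multiset_map_count, Finsupp.prod,
        Multiset.toFinsupp_support]
      rfl
    simp only [map_sum, hmon]
    refine h g hg ?_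
    have := hgc 0 (Nat.zero_le m)
    simpa using this
  ext p
  have h2 := congrArg (MvPolynomial.coeff (Multiset.toFinsupp p.parts)) hQ
  have hinj : ∀ q : Nat.Partition m,
      Multiset.toFinsupp q.parts = Multiset.toFinsupp p.parts ↔ q = p :=
    fun q => ⟨fun h => Nat.Partition.ext (Multiset.toFinsupp.injective h), fun h => by rw [h]⟩
  simpa [MvPolynomial.coeff_sum, MvPolynomial.coeff_monomial, hinj] using h2

/-! ### Homogeneous coordinates -/

theorem MvPolynomial.IsHomogeneous.eval_smul {σ : Type*} {F : MvPolynomial σ ℂ} {d : ℕ}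
    (hF : F.IsHomogeneous d) (c : ℂ) (v : σ → ℂ) : eval (c • v) F = c ^ d * eval v F := by
  rw [eval_eq, eval_eq, Finset.mul_sum]
  refine Finset.sum_congr rfl fun e he => ?_
  have h := hF (mem_support_iff.mp he)
  rw [Finsupp.weight_apply, Finsupp.sum] at h
  simp only [Pi.one_apply, smul_eq_mul, mul_one] at h
  simp only [Pi.smul_apply, smul_eq_mul, mul_pow, Finset.prod_mul_distrib]
  rw [Finset.prod_pow_eq_pow_sum, h]
  ring

theorem exists_rep_mk_eq (v : Fin 3 → ℂ) (hv : v ≠ 0) :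
    ∃ c : ℂ, c ≠ 0 ∧ (Projectivization.mk ℂ v hv).rep = c • v := by
  obtain ⟨c, hc⟩ := Projectivization.exists_smul_eq_mk_rep ℂ v hv
  exact ⟨c, c.ne_zero, hc.symm⟩

theorem eval_rep_mk_eq_zero_iff {F : MvPolynomial (Fin 3) ℂ} {d : ℕ} (hF : F.IsHomogeneous d)
    (v : Fin 3 → ℂ) (hv : v ≠ 0) :
    eval (Projectivization.mk ℂ v hv).rep F = 0 ↔ eval v F = 0 := by
  obtain ⟨c, hc, h⟩ := exists_rep_mk_eq v hv
  rw [h, hF.eval_smul]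
  simp [hc]

theorem mk_mem_lineAtInfinity_iff (v : Fin 3 → ℂ) (hv : v ≠ 0) :
    Projectivization.mk ℂ v hv ∈ lineAtInfinity ↔ v 0 = 0 := by
  obtain ⟨c, hc, h⟩ := exists_rep_mk_eq v hv
  change (Projectivization.mk ℂ v hv).rep 0 = 0 ↔ _
  simp [h, hc]

theorem affX_mk (v : Fin 3 → ℂ) (hv : v ≠ 0) : affX (Projectivization.mk ℂ v hv) = v 1 / v 0 := by
  obtain ⟨c, hc, h⟩ := exists_rep_mk_eq v hv
  simp [affX, h, mul_div_mul_left _ _ hc]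

theorem affY_mk (v : Fin 3 → ℂ) (hv : v ≠ 0) : affY (Projectivization.mk ℂ v hv) = v 2 / v 0 := by
  obtain ⟨c, hc, h⟩ := exists_rep_mk_eq v hv
  simp [affY, h, mul_div_mul_left _ _ hc]

theorem eval_affineEq (F : MvPolynomial (Fin 3) ℂ) (x y : ℂ) :
    eval ![x, y] (affineEq F) = eval ![1, x, y] F := by
  unfold affineEq
  induction F using MvPolynomial.induction_on with
  | C a => simp
  | add p q hp hq => simp only [map_add, hp, hq]
  | mul_X p i hp =>
    rw [map_mul, map_mul, map_mul, hp, aeval_X, eval_X]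
    congr 1
    fin_cases i <;> simp

theorem pderiv_zero_affineEq (F : MvPolynomial (Fin 3) ℂ) :
    pderiv 0 (affineEq F) = affineEq (pderiv 1 F) := by
  unfold affineEq
  induction F using MvPolynomial.induction_on with
  | C a => simp
  | add p q hp hq => simp only [map_add, hp, hq]
  | mul_X p i hp =>
    rw [map_mul, Derivation.leibniz, Derivation.leibniz, hp]
    fin_cases i <;> simp [pderiv_X]

theorem pderiv_one_affineEq (F : MvPolynomial (Fin 3) ℂ) :
    pderiv 1 (affineEq F) = affineEq (pderiv 2 F) := by
  unfold affineEq
  induction F using MvPolynomial.induction_on with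
  | C a => simp
  | add p q hp hq => simp only [map_add, hp, hq]
  | mul_X p i hp =>
    rw [map_mul, Derivation.leibniz, Derivation.leibniz, hp]
    fin_cases i <;> simp [pderiv_X]

/-- The homogeneous partial derivative `F_{X^i Y^j}`. -/
def homPartial (F : MvPolynomial (Fin 3) ℂ) (i j : ℕ) : MvPolynomial (Fin 3) ℂ :=
  (pderiv 1)^[i] ((pderiv 2)^[j] F)

theorem partialDeriv_affineEq (F : MvPolynomial (Fin 3) ℂ) (i j : ℕ) (x y : ℂ) :
    partialDeriv (affineEq F) i j x y = eval ![1, x, y] (homPartial F i j) := by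
  have h0 : ∀ k P, (pderiv 0)^[k] (affineEq P) = affineEq ((pderiv 1)^[k] P) := fun k P =>
    ((Function.Semiconj.iterate_right (f := affineEq)
      (fun Q => (pderiv_zero_affineEq Q).symm) k) P).symm
  have h1 : ∀ k P, (pderiv 1)^[k] (affineEq P) = affineEq ((pderiv 2)^[k] P) := fun k P =>
    ((Function.Semiconj.iterate_right (f := affineEq)
      (fun Q => (pderiv_one_affineEq Q).symm) k) P).symm
  rw [partialDeriv, h1, h0, eval_affineEq, homPartial]

theorem isHomogeneous_homPartial {F : MvPolynomial (Fin 3) ℂ} {d : ℕ} (hF : F.IsHomogeneous d)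
    (i j : ℕ) : (homPartial F i j).IsHomogeneous (d - (i + j)) := by
  have h : ∀ (a : Fin 3) (P : MvPolynomial (Fin 3) ℂ) (n k : ℕ), P.IsHomogeneous n →
      ((pderiv a)^[k] P).IsHomogeneous (n - k) := by
    intro a P n k hP
    induction k with
    | zero => exact hP
    | succ k ih =>
      rw [Function.iterate_succ_apply']
      exact ih.pderiv
  have := h 1 _ _ i (h 2 F d j hF)
  rwa [Nat.sub_sub, add_comm j i] at this

/-- The derivative `R_{x^i y^j}` in homogeneous coordinates. The bound on `i + j` excludes a truncation
of the degree `d - (i + j)`. -/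
theorem partialDeriv_affineEq_div {F : MvPolynomial (Fin 3) ℂ} {d : ℕ} (hF : F.IsHomogeneous d)
    {i j : ℕ} (hij : i + j ≤ d) {v : Fin 3 → ℂ} (hv : v 0 ≠ 0) :
    partialDeriv (affineEq F) i j (v 1 / v 0) (v 2 / v 0) =
      v 0 ^ ((i : ℤ) + j - d) * eval v (homPartial F i j) := by
  have h : ![1, v 1 / v 0, v 2 / v 0] = (v 0)⁻¹ • v := by
    ext k
    fin_cases k <;> simp [hv, div_eq_inv_mul]
  rw [partialDeriv_affineEq, h, (isHomogeneous_homPartial hF i j).eval_smul, inv_pow,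
    ← zpow_natCast, ← zpow_neg]
  congr 2
  push_cast [hij]
  ring

theorem analyticAt_partialDeriv (R : MvPolynomial (Fin 2) ℂ) (i j : ℕ) {x y : ℂ → ℂ} {z : ℂ}
    (hx : AnalyticAt ℂ x z) (hy : AnalyticAt ℂ y z) :
    AnalyticAt ℂ (fun t => partialDeriv R i j (x t) (y t)) z := by
  refine AnalyticAt.aeval_mvPolynomial (A := ℂ) (B := ℂ) (f := fun t => ![x t, y t]) (fun k => ?_)
    ((pderiv 0)^[i] ((pderiv 1)^[j] R))
  fin_cases k
  · exact hx
  · exact hy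

theorem partialDeriv_zero_zero_affineEq {F : MvPolynomial (Fin 3) ℂ} {d : ℕ}
    (hF : F.IsHomogeneous d) {p : P2} (hp : p ∈ planeCurve F) (hinf : p ∉ lineAtInfinity) :
    partialDeriv (affineEq F) 0 0 (affX p) (affY p) = 0 := by
  have h := partialDeriv_affineEq_div hF (Nat.zero_le d) (i := 0) (j := 0) (v := p.rep) hinf
  have h2 : eval p.rep (homPartial F 0 0) = 0 := hp
  rwa [h2, mul_zero] at h

/-- At an affine point of a smooth curve, `R_x` and `R_y` do not vanish simultaneously, by Euler's
identity. -/
theorem IsSmoothPlaneCurve.partialDeriv_ne_zero {F : MvPolynomial (Fin 3) ℂ} {d : ℕ}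
    (hF : IsSmoothPlaneCurve F d) {p : P2} (hp : p ∈ planeCurve F) (hinf : p ∉ lineAtInfinity) :
    partialDeriv (affineEq F) 1 0 (affX p) (affY p) ≠ 0 ∨
      partialDeriv (affineEq F) 0 1 (affX p) (affY p) ≠ 0 := by
  by_contra! h
  have h0 := partialDeriv_zero_zero_affineEq hF.homogeneous hp hinf
  rw [partialDeriv_affineEq] at h0
  rw [partialDeriv_affineEq, partialDeriv_affineEq] at h
  simp only [homPartial, Function.iterate_one, Function.iterate_zero, id_eq] at h0 h
  obtain ⟨i, hi⟩ := hF.smooth ![1, affX p, affY p] (fun h => by simpa using congrFun h 0) h0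
  have hE := congrArg (eval ![1, affX p, affY p]) hF.homogeneous.sum_X_mul_pderiv
  rw [map_nsmul, h0, Fin.sum_univ_three] at hE
  simp only [map_add, map_mul, eval_X, h.1, h.2] at hE
  fin_cases i
  · exact hi (by simpa using hE)
  · exact hi h.1
  · exact hi h.2

/-! ### Holomorphic maps to the plane -/

theorem HolomorphicAtP2.eventually_affine {f : ℂ → P2} {z : ℂ} (hf : HolomorphicAtP2 f z)
    (h : f z ∉ lineAtInfinity) :
    AnalyticAt ℂ (affX ∘ f) z ∧ AnalyticAt ℂ (affY ∘ f) z ∧ ∀ᶠ w in 𝓝 z, f w ∉ lineAtInfinity := by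
  obtain ⟨v, hv, hfv⟩ := hf
  have hvi : ∀ i, AnalyticAt ℂ (fun w => v w i) z := fun i => analyticAt_pi_iff.mp hv i
  obtain ⟨hz, hfz⟩ := hfv.self_of_nhds
  rw [hfz, mk_mem_lineAtInfinity_iff] at h
  refine ⟨((hvi 1).div (hvi 0) h).congr ?_, ((hvi 2).div (hvi 0) h).congr ?_, ?_⟩
  · filter_upwards [hfv] with w ⟨hw, hfw⟩
    simp [hfw, affX_mk]
  · filter_upwards [hfv] with w ⟨hw, hfw⟩
    simp [hfw, affY_mk]
  · filter_upwards [hfv, (hvi 0).continuousAt.eventually_ne h] with w ⟨hw, hfw⟩ h0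
    rwa [hfw, mk_mem_lineAtInfinity_iff]

theorem HolomorphicAtP2.comp {φ : ℂ → P2} {g : ℂ → ℂ} {z : ℂ} (hφ : HolomorphicAtP2 φ (g z))
    (hg : AnalyticAt ℂ g z) : HolomorphicAtP2 (φ ∘ g) z := by
  obtain ⟨v, hv, h⟩ := hφ
  exact ⟨v ∘ g, hv.comp hg, hg.continuousAt.eventually h⟩

theorem IsLocalParam.isCurveGerm_comp {X : Set P2} {U : Set ℂ} {φ : ℂ → P2}
    (hφ : IsLocalParam X U φ) {g : ℂ → ℂ} (hg : AnalyticAt ℂ g 0) (hU : g 0 ∈ U) :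
    IsCurveGerm X (φ ∘ g) where
  holomorphic := (hφ.holomorphic _ hU).comp hg
  mem := (hg.continuousAt.eventually (hφ.isOpen.mem_nhds hU)).mono fun _ h => hφ.mapsTo _ h

/-! ### The jet differential -/

open Classical in
/-- The value on the germ `f` of the jet differential attached to the family `J`, on the curve
`F = 0`. -/
def curveJetDiff (J : JetFamily) (n : ℕ) (F : MvPolynomial (Fin 3) ℂ) (f : ℂ → P2) : ℂ :=
  if f 0 ∈ lineAtInfinity then 0
  else if partialDeriv (affineEq F) 1 0 (affX (f 0)) (affY (f 0)) ≠ 0 then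
    ySide J n (affineEq F) (affX ∘ f) (affY ∘ f)
  else xSide J n (affineEq F) (affX ∘ f) (affY ∘ f)

section

variable {J : JetFamily} {n : ℕ} {F : MvPolynomial (Fin 3) ℂ} {f : ℂ → P2}

theorem curveJetDiff_of_mem (h : f 0 ∈ lineAtInfinity) : curveJetDiff J n F f = 0 :=
  if_pos h

theorem curveJetDiff_eq_ySide (h : f 0 ∉ lineAtInfinity)
    (hx : partialDeriv (affineEq F) 1 0 (affX (f 0)) (affY (f 0)) ≠ 0) :
    curveJetDiff J n F f = ySide J n (affineEq F) (affX ∘ f) (affY ∘ f) := by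
  rw [curveJetDiff, if_neg h, if_pos hx]

theorem curveJetDiff_eq_xSide (hJ : IsGeneratingFamily J) (hn : 1 ≤ n) {d : ℕ}
    (hF : F.IsHomogeneous d) (hf : IsCurveGerm (planeCurve F) f) (h : f 0 ∉ lineAtInfinity)
    (hy : partialDeriv (affineEq F) 0 1 (affX (f 0)) (affY (f 0)) ≠ 0) :
    curveJetDiff J n F f = xSide J n (affineEq F) (affX ∘ f) (affY ∘ f) := by
  by_cases hx : partialDeriv (affineEq F) 1 0 (affX (f 0)) (affY (f 0)) ≠ 0
  · obtain ⟨h1, h2, h3⟩ := hf.holomorphic.eventually_affine h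
    rw [curveJetDiff_eq_ySide h hx]
    refine hJ.symmetric_eq n hn _ _ _ h1 h2 ?_ hx hy
    filter_upwards [h3, hf.mem] with w h3 h4
    exact partialDeriv_zero_zero_affineEq hF h4 h3
  · rw [curveJetDiff, if_neg h, if_neg hx]

end

/-! ### Local expansions of the jet differential -/

theorem IsOrderFiltration.neg_mem {C : ℤ → AddSubmonoid (ℂ → ℂ)} (hC : IsOrderFiltration C) {k : ℤ}
    {f : ℂ → ℂ} (hf : f ∈ C k) : -f ∈ C k := by
  have h := hC.mul_mem (hC.const_mem (-1)) hf
  rwa [zero_add, show Function.const ℂ (-1 : ℂ) * f = -f by ext; simp] at h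

section

variable {J : JetFamily} {n : ℕ} {F : MvPolynomial (Fin 3) ℂ} {U : Set ℂ} {φ : ℂ → P2}
  {l : Filter ℂ} {C : ℤ → AddSubmonoid (ℂ → ℂ)} {α β γ : ℤ}

/-- The weight count applied to the expression in the jets of `y`, where `R_x` does not vanish. -/
theorem isJetPoly_curveJetDiff_of_x (hC : IsOrderFiltration C) (hβ : 0 ≤ β)
    (hJ : IsGeneratingFamily J) (hn : 1 ≤ n)
    (hl : ∀ᶠ t in l, φ t ∉ lineAtInfinity ∧ AnalyticAt ℂ (affY ∘ φ) t ∧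
      partialDeriv (affineEq F) 1 0 (affX (φ t)) (affY (φ t)) ≠ 0)
    (hder : ∀ k : ℕ, iteratedDeriv k (affY ∘ φ) ∈ C (-α - β * k))
    (hr : ∀ i j : ℕ, 1 ≤ i + j → i + j ≤ n →
      (fun t => partialDeriv (affineEq F) i j (affX (φ t)) (affY (φ t)) /
        partialDeriv (affineEq F) 1 0 (affX (φ t)) (affY (φ t))) ∈ C (α * ((i : ℤ) + j - 1)))
    (hD : (fun t => (partialDeriv (affineEq F) 1 0 (affX (φ t)) (affY (φ t)))⁻¹) ∈ C γ) :
    IsJetPoly l (C (γ - α - β * n)) n fun g => curveJetDiff J n F (φ ∘ g) := by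
  have h := isJetPoly_sideExpr hC hβ hJ hn (hl.mono fun t ht => ht.2.1) hder
    (r := fun t s => partialDeriv (affineEq F) s.1 s.2 (affX (φ t)) (affY (φ t)) /
      partialDeriv (affineEq F) 1 0 (affX (φ t)) (affY (φ t)))
    (fun s hs hsn => hr s.1 s.2 hs hsn) hD
  refine h.congr (hl.mono fun t ht g hg hgt => ?_)
  subst hgt
  exact curveJetDiff_eq_ySide (f := φ ∘ g) ht.1 ht.2.2

/-- The weight count applied to the expression in the jets of `x`, where `R_y` does not vanish. -/
theorem isJetPoly_curveJetDiff_of_y (hC : IsOrderFiltration C) (hβ : 0 ≤ β)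
    (hJ : IsGeneratingFamily J) (hn : 1 ≤ n) {d : ℕ} (hF : F.IsHomogeneous d)
    (hφ : IsLocalParam (planeCurve F) U φ)
    (hl : ∀ᶠ t in l, t ∈ U ∧ φ t ∉ lineAtInfinity ∧ AnalyticAt ℂ (affX ∘ φ) t ∧
      partialDeriv (affineEq F) 0 1 (affX (φ t)) (affY (φ t)) ≠ 0)
    (hder : ∀ k : ℕ, iteratedDeriv k (affX ∘ φ) ∈ C (-α - β * k))
    (hr : ∀ i j : ℕ, 1 ≤ i + j → i + j ≤ n →
      (fun t => partialDeriv (affineEq F) i j (affX (φ t)) (affY (φ t)) /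
        partialDeriv (affineEq F) 0 1 (affX (φ t)) (affY (φ t))) ∈ C (α * ((i : ℤ) + j - 1)))
    (hD : (fun t => (partialDeriv (affineEq F) 0 1 (affX (φ t)) (affY (φ t)))⁻¹) ∈ C γ) :
    IsJetPoly l (C (γ - α - β * n)) n fun g => curveJetDiff J n F (φ ∘ g) := by
  have h := isJetPoly_sideExpr hC hβ hJ hn (hl.mono fun t ht => ht.2.2.1) hder
    (r := fun t s => partialDeriv (affineEq F) s.2 s.1 (affX (φ t)) (affY (φ t)) /
      partialDeriv (affineEq F) 0 1 (affX (φ t)) (affY (φ t)))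
    (fun s hs hsn => by
      have := hr s.2 s.1 (by omega) (by omega)
      rwa [add_comm (s.2 : ℤ)] at this) hD
  refine (h.neg fun f hf => hC.neg_mem hf).congr (hl.mono fun t ht g hg hgt => ?_)
  subst hgt
  exact curveJetDiff_eq_xSide hJ hn hF (hφ.isCurveGerm_comp hg ht.1) ht.2.1 ht.2.2.2

theorem isJetPoly_curveJetDiff_affine (hJ : IsGeneratingFamily J) (hn : 1 ≤ n) {d : ℕ}
    (hF : IsSmoothPlaneCurve F d) (hφ : IsLocalParam (planeCurve F) U φ) {t₀ : ℂ} (ht₀ : t₀ ∈ U)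
    (hinf : φ t₀ ∉ lineAtInfinity) :
    IsJetPoly (𝓝 t₀) (analyticFunctions t₀) n fun g => curveJetDiff J n F (φ ∘ g) := by
  obtain ⟨hx, hy, hl⟩ := (hφ.holomorphic t₀ ht₀).eventually_affine hinf
  have hR : ∀ i j, AnalyticAt ℂ
      (fun t => partialDeriv (affineEq F) i j (affX (φ t)) (affY (φ t))) t₀ :=
    fun i j => analyticAt_partialDeriv _ i j hx hy
  rcases hF.partialDeriv_ne_zero (hφ.mapsTo t₀ ht₀) hinf with h | h
  · refine isJetPoly_curveJetDiff_of_x (α := 0) (β := 0) (γ := 0)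
      (isOrderFiltration_analyticFunctions t₀) le_rfl hJ hn ?_
      (fun k => iteratedDeriv_mem_analyticFunctions hy k) (fun i j _ _ => (hR i j).div (hR 1 0) h)
      ((hR 1 0).inv h)
    filter_upwards [hl, hy.eventually_analyticAt, (hR 1 0).continuousAt.eventually_ne h]
      with t h1 h2 h3 using ⟨h1, h2, h3⟩
  · refine isJetPoly_curveJetDiff_of_y (α := 0) (β := 0) (γ := 0)
      (isOrderFiltration_analyticFunctions t₀) le_rfl hJ hn hF.homogeneous hφ ?_
      (fun k => iteratedDeriv_mem_analyticFunctions hx k) (fun i j _ _ => (hR i j).div (hR 0 1) h)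
      ((hR 0 1).inv h)
    filter_upwards [hφ.isOpen.mem_nhds ht₀, hl, hx.eventually_analyticAt,
      (hR 0 1).continuousAt.eventually_ne h] with t h0 h1 h2 h3 using ⟨h0, h1, h2, h3⟩

/-- An expansion on a punctured neighbourhood of `t₀` with coefficients of positive order at `t₀`
extends by zero to `t₀`. -/
theorem IsJetPoly.extend {t₀ : ℂ} {k : ℤ} (hk : 0 < k) {Φ : (ℂ → ℂ) → ℂ}
    (h : IsJetPoly (𝓝[≠] t₀) (functionsOfOrder t₀ k) n Φ) (h0 : ∀ g : ℂ → ℂ, g 0 = t₀ → Φ g = 0) :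
    IsJetPoly (𝓝 t₀) (analyticFunctions t₀) n Φ := by
  obtain ⟨a, ha, h⟩ := h
  choose b hb hab using ha
  lift k to ℕ using hk.le
  refine ⟨fun p t => (t - t₀) ^ k * b p t, fun p => ?_, ?_⟩
  · have := hb p
    change AnalyticAt ℂ (fun t => (t - t₀) ^ k * b p t) t₀
    fun_prop
  · have hab' : ∀ᶠ t in 𝓝[≠] t₀, ∀ p, a p t = (t - t₀) ^ (k : ℤ) * b p t := eventually_all.mpr hab
    filter_upwards [eventually_nhdsWithin_iff.mp (h.and hab')] with t ht g hg hgt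
    by_cases htt : t = t₀
    · rw [h0 g (hgt.trans htt), hgt, htt]
      simp [show k ≠ 0 by omega]
    · obtain ⟨h1, h2⟩ := ht htt
      rw [h1 g hg hgt, hgt]
      refine Finset.sum_congr rfl fun p _ => ?_
      rw [h2 p, zpow_natCast]

/-- A local homogeneous representation of a parametrization near a point at infinity: the first
homogeneous coordinate vanishes there to a finite positive order `m`. -/
theorem IsLocalParam.exists_order (hφ : IsLocalParam (planeCurve F) U φ)
    (hfin : (planeCurve F ∩ lineAtInfinity).Finite) {t₀ : ℂ} (ht₀ : t₀ ∈ U)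
    (hinf : φ t₀ ∈ lineAtInfinity) :
    ∃ (v : ℂ → Fin 3 → ℂ) (m : ℕ) (h : ℂ → ℂ), (∀ i, AnalyticAt ℂ (fun t => v t i) t₀) ∧
      (∃ h0 : v t₀ ≠ 0, φ t₀ = Projectivization.mk ℂ (v t₀) h0) ∧
      1 ≤ m ∧ AnalyticAt ℂ h t₀ ∧ h t₀ ≠ 0 ∧ (∀ᶠ t in 𝓝 t₀, v t 0 = (t - t₀) ^ m * h t) ∧
      ∀ᶠ t in 𝓝[≠] t₀, v t 0 ≠ 0 ∧ φ t ∉ lineAtInfinity ∧ affX (φ t) = v t 1 / v t 0 ∧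
        affY (φ t) = v t 2 / v t 0 := by
  obtain ⟨v, hv, hφv⟩ := hφ.holomorphic t₀ ht₀
  have hvi : ∀ i, AnalyticAt ℂ (fun w => v w i) t₀ := fun i => analyticAt_pi_iff.mp hv i
  -- Otherwise the injective map `φ` sends a neighbourhood of `t₀` to the finite set of points at
  -- infinity.
  have hne : ¬ ∀ᶠ t in 𝓝 t₀, v t 0 = 0 := by
    intro h0
    have hS : U ∩ {t | φ t ∈ planeCurve F ∩ lineAtInfinity} ∈ 𝓝 t₀ := by
      filter_upwards [hφ.isOpen.mem_nhds ht₀, h0, hφv] with t h1 h2 ⟨h3, h4⟩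
      exact ⟨h1, hφ.mapsTo t h1, by rwa [h4, mk_mem_lineAtInfinity_iff]⟩
    refine infinite_of_mem_nhds t₀ hS (Set.Finite.of_finite_image (f := φ) ?_
      (hφ.injOn.mono Set.inter_subset_left))
    refine hfin.subset ?_
    rintro _ ⟨t, ⟨-, ht⟩, rfl⟩
    exact ht
  obtain ⟨m, h, hh, hh0, hm⟩ := (hvi 0).exists_eventuallyEq_pow_smul_nonzero_iff.mpr hne
  simp only [smul_eq_mul] at hm
  obtain ⟨hz, hφz⟩ := hφv.self_of_nhds
  refine ⟨v, m, h, hvi, ⟨hz, hφz⟩, ?_, hh, hh0, hm, ?_⟩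
  · rw [Nat.one_le_iff_ne_zero]
    rintro rfl
    have h1 := hm.self_of_nhds
    rw [hφz, mk_mem_lineAtInfinity_iff] at hinf
    simp [hinf] at h1
    exact hh0 h1.symm
  · filter_upwards [hφv.filter_mono nhdsWithin_le_nhds, hm.filter_mono nhdsWithin_le_nhds,
      (hh.continuousAt.eventually_ne hh0).filter_mono nhdsWithin_le_nhds, self_mem_nhdsWithin]
      with t ⟨h1, h2⟩ h3 h4 h5
    have h6 : v t 0 ≠ 0 := by
      rw [h3]
      exact mul_ne_zero (pow_ne_zero _ (sub_ne_zero.mpr h5)) h4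
    rw [h2, mk_mem_lineAtInfinity_iff, affX_mk, affY_mk]
    exact ⟨h6, h6, rfl, rfl⟩

/-- If `s` has a zero of order exactly `m` at `t₀`, then `s ^ N * q` has order at least `m N`. -/
theorem zpow_mul_mem_functionsOfOrder {t₀ : ℂ} {m : ℕ} {s h q f : ℂ → ℂ} (hh : AnalyticAt ℂ h t₀)
    (hh0 : h t₀ ≠ 0) (hs : ∀ᶠ t in 𝓝[≠] t₀, s t = (t - t₀) ^ m * h t) (hq : AnalyticAt ℂ q t₀)
    (N : ℤ) (hf : ∀ᶠ t in 𝓝[≠] t₀, f t = s t ^ N * q t) : f ∈ functionsOfOrder t₀ (m * N) := by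
  refine mem_functionsOfOrder.mpr ⟨h ^ N * q, (hh.zpow hh0).mul hq, ?_⟩
  filter_upwards [hs, hf] with t h1 h2
  rw [h2, h1, mul_zpow, zpow_mul, zpow_natCast, Pi.mul_apply, Pi.pow_apply, mul_assoc]

/-- At a point at infinity, `x` and `y` have poles of order `m`, the derivative `R_{x^i y^j}` has a
pole of order at most `m (d - i - j)`, and `R_x` or `R_y` a pole of order `m (d - 1)`. The
coefficients have thus order at least `m (d - 2) - n`, which is positive. -/
theorem isJetPoly_curveJetDiff_infinity (hJ : IsGeneratingFamily J) (hn : 1 ≤ n) {d : ℕ}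
    (hd : n + 3 ≤ d) (hF : F.IsHomogeneous d) (hA : IsAdapted F d)
    (hφ : IsLocalParam (planeCurve F) U φ) {t₀ : ℂ} (ht₀ : t₀ ∈ U)
    (hinf : φ t₀ ∈ lineAtInfinity) :
    IsJetPoly (𝓝 t₀) (analyticFunctions t₀) n fun g => curveJetDiff J n F (φ ∘ g) := by
  have hfin : (planeCurve F ∩ lineAtInfinity).Finite :=
    Set.finite_of_ncard_pos (by rw [hA.card_infinity]; omega)
  obtain ⟨v, m, h, hv, ⟨hv0, hφ0⟩, hm, hh, hh0, hvm, hl⟩ := hφ.exists_order hfin ht₀ hinf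
  have hvm' := hvm.filter_mono (nhdsWithin_le_nhds (s := {t₀}ᶜ))
  have hG : ∀ i j, AnalyticAt ℂ (fun t => eval (v t) (homPartial F i j)) t₀ := fun i j =>
    AnalyticAt.aeval_mvPolynomial (A := ℂ) (B := ℂ) hv (homPartial F i j)
  -- The order is `m (d - 2) - n ≥ d - 2 - n ≥ 1`.
  have hpos : 0 < (m * (d - 1) : ℤ) - m - 1 * n := by
    have h1 : (1 : ℤ) ≤ m := by exact_mod_cast hm
    have h2 : (n : ℤ) + 3 ≤ d := by exact_mod_cast hd
    nlinarith
  have hx : ∀ k : ℕ, iteratedDeriv k (affX ∘ φ) ∈ functionsOfOrder t₀ (-m - 1 * k) := fun k => by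
    rw [one_mul]
    refine iteratedDeriv_mem_functionsOfOrder ?_ k
    rw [← mul_neg_one]
    refine zpow_mul_mem_functionsOfOrder hh hh0 hvm' (hv 1) (-1) (hl.mono fun t ht => ?_)
    rw [Function.comp_apply, ht.2.2.1, zpow_neg_one, div_eq_inv_mul]
  have hy : ∀ k : ℕ, iteratedDeriv k (affY ∘ φ) ∈ functionsOfOrder t₀ (-m - 1 * k) := fun k => by
    rw [one_mul]
    refine iteratedDeriv_mem_functionsOfOrder ?_ k
    rw [← mul_neg_one]
    refine zpow_mul_mem_functionsOfOrder hh hh0 hvm' (hv 2) (-1) (hl.mono fun t ht => ?_)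
    rw [Function.comp_apply, ht.2.2.2, zpow_neg_one, div_eq_inv_mul]
  have hquot : ∀ a b : ℕ, a + b = 1 → eval (v t₀) (homPartial F a b) ≠ 0 →
      ∀ i j : ℕ, 1 ≤ i + j → i + j ≤ n →
      (fun t => partialDeriv (affineEq F) i j (affX (φ t)) (affY (φ t)) /
        partialDeriv (affineEq F) a b (affX (φ t)) (affY (φ t))) ∈
          functionsOfOrder t₀ (m * ((i : ℤ) + j - 1)) := by
    intro a b hab hne i j _ hij
    refine zpow_mul_mem_functionsOfOrder hh hh0 hvm' ((hG i j).div (hG a b) hne) _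
      (hl.mono fun t ht => ?_)
    have hab' : (a : ℤ) + b = 1 := by exact_mod_cast hab
    rw [ht.2.2.1, ht.2.2.2, partialDeriv_affineEq_div hF (by omega) ht.1,
      partialDeriv_affineEq_div hF (by omega) ht.1, mul_div_mul_comm, ← zpow_sub₀ ht.1, hab',
      Pi.div_apply]
    congr 2
    ring
  have hinv : ∀ a b : ℕ, a + b = 1 → eval (v t₀) (homPartial F a b) ≠ 0 →
      (fun t => (partialDeriv (affineEq F) a b (affX (φ t)) (affY (φ t)))⁻¹) ∈
          functionsOfOrder t₀ (m * (d - 1)) := by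
    intro a b hab hne
    refine zpow_mul_mem_functionsOfOrder hh hh0 hvm' ((hG a b).inv hne) _ (hl.mono fun t ht => ?_)
    have hab' : (a : ℤ) + b = 1 := by exact_mod_cast hab
    rw [ht.2.2.1, ht.2.2.2, partialDeriv_affineEq_div hF (by omega) ht.1, mul_inv, ← zpow_neg,
      hab', neg_sub, Pi.inv_apply]
  have hne : ∀ a b : ℕ, a + b = 1 → eval (v t₀) (homPartial F a b) ≠ 0 → ∀ᶠ t in 𝓝[≠] t₀,
      partialDeriv (affineEq F) a b (affX (φ t)) (affY (φ t)) ≠ 0 := by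
    intro a b hab hne
    filter_upwards [hl, ((hG a b).continuousAt.eventually_ne hne).filter_mono nhdsWithin_le_nhds]
      with t ht ht2
    rw [ht.2.2.1, ht.2.2.2, partialDeriv_affineEq_div hF (by omega) ht.1]
    exact mul_ne_zero (zpow_ne_zero _ ht.1) ht2
  have hU : ∀ᶠ t in 𝓝[≠] t₀, t ∈ U :=
    (hφ.isOpen.eventually_mem ht₀).filter_mono nhdsWithin_le_nhds
  have han : ∀ᶠ t in 𝓝[≠] t₀, AnalyticAt ℂ (affX ∘ φ) t ∧ AnalyticAt ℂ (affY ∘ φ) t := by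
    filter_upwards [hU, hl] with t h1 h2
    exact ⟨((hφ.holomorphic t h1).eventually_affine h2.2.1).1,
      ((hφ.holomorphic t h1).eventually_affine h2.2.1).2.1⟩
  refine IsJetPoly.extend hpos ?_ fun g hg => curveJetDiff_of_mem (by
    rwa [Function.comp_apply, hg])
  have htr := hA.transversal (φ t₀) ⟨hφ.mapsTo t₀ ht₀, hinf⟩
  rw [hφ0, Ne, Ne, eval_rep_mk_eq_zero_iff hF.pderiv, eval_rep_mk_eq_zero_iff hF.pderiv] at htr
  rcases htr with h1 | h1
  · refine isJetPoly_curveJetDiff_of_x (isOrderFiltration_functionsOfOrder t₀) zero_le_one hJ hn ?_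
      hy (hquot 1 0 rfl h1) (hinv 1 0 rfl h1)
    filter_upwards [hl, han, hne 1 0 rfl h1] with t h2 h3 h4 using ⟨h2.2.1, h3.2, h4⟩
  · refine isJetPoly_curveJetDiff_of_y (isOrderFiltration_functionsOfOrder t₀) zero_le_one hJ hn hF
      hφ ?_ hx (hquot 0 1 rfl h1) (hinv 0 1 rfl h1)
    filter_upwards [hU, hl, han, hne 0 1 rfl h1] with t h0 h2 h3 h4 using ⟨h0, h2.2.1, h3.1, h4⟩

end

/-! ### Gluing -/

theorem isLocalExpansion_iff {n : ℕ} {ω : (ℂ → P2) → ℂ} {U : Set ℂ} {φ : ℂ → P2}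
    {a : Nat.Partition n → ℂ → ℂ} :
    IsLocalExpansion n n ω U φ a ↔ ∀ g : ℂ → ℂ, AnalyticAt ℂ g 0 → g 0 ∈ U →
      ω (φ ∘ g) = ∑ p, a p (g 0) * jetMonomial p g := by
  have h : (Finset.univ.filter fun p : Nat.Partition n => ∀ j ∈ p.parts, j ≤ n) = Finset.univ :=
    Finset.filter_true_of_mem fun p _ j hj => p.le_of_mem_parts hj
  rw [IsLocalExpansion, h]
  rfl

/-- The local expansions glue, since their coefficients are unique. -/
theorem exists_isLocalExpansion {n : ℕ} {ω : (ℂ → P2) → ℂ} {U : Set ℂ} {φ : ℂ → P2}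
    (hU : IsOpen U) (h : ∀ t ∈ U, IsJetPoly (𝓝 t) (analyticFunctions t) n fun g => ω (φ ∘ g)) :
    ∃ a : Nat.Partition n → ℂ → ℂ, (∀ p, DifferentiableOn ℂ (a p) U) ∧
      IsLocalExpansion n n ω U φ a := by
  choose! a ha hexp using h
  -- The coefficients at `t` are the values at `t` of those of the expansion near `t`.
  refine ⟨fun p t => a t p t, fun p t ht => ?_, isLocalExpansion_iff.mpr fun g hg hgU =>
    (hexp (g 0) hgU).self_of_nhds g hg rfl⟩
  have heq : (fun s => a s p s) =ᶠ[𝓝 t] a t p := by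
    filter_upwards [hexp t ht, hU.mem_nhds ht] with s hs hsU
    refine congrFun (eq_of_jetMonomial_sum_eq s (fun p => a s p s) (fun p => a t p s)
      fun g hg hgs => ?_) p
    have h1 := hs g hg hgs
    have h2 := (hexp s hsU).self_of_nhds g hg hgs
    rw [hgs] at h1 h2
    rw [← h1, ← h2]
  exact ((ha t ht p).congr heq.symm).differentiableAt.differentiableWithinAt

theorem isHolomorphicJetDifferential_curveJetDiff {J : JetFamily} (hJ : IsGeneratingFamily J)
    {n d : ℕ} (hn : 1 ≤ n) (hd : n + 3 ≤ d) {F : MvPolynomial (Fin 3) ℂ}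
    (hF : IsSmoothPlaneCurve F d) (hA : IsAdapted F d) :
    IsHolomorphicJetDifferential (planeCurve F) n n (curveJetDiff J n F) := by
  intro U φ hφ
  refine exists_isLocalExpansion hφ.isOpen fun t ht => ?_
  by_cases hinf : φ t ∈ lineAtInfinity
  · exact isJetPoly_curveJetDiff_infinity hJ hn hd hF.homogeneous hA hφ ht hinf
  · exact isJetPoly_curveJetDiff_affine hJ hn hF hφ ht hinf

/-- A jet differential whose values on all germs centred on `D` are zero vanishes on `D`, because
the jet monomials are linearly independent. -/
theorem vanishesOn_of_forall_germ {X D : Set P2} {n : ℕ} {ω : (ℂ → P2) → ℂ}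
    (h : ∀ f : ℂ → P2, f 0 ∈ D → ω f = 0) : VanishesOn X n n ω D := by
  intro U φ hφ a ha t ht htD p _
  rw [isLocalExpansion_iff] at ha
  refine congrFun (eq_of_jetMonomial_sum_eq t (fun p => a p t) 0 fun g hg hgt => ?_) p
  have h1 := ha g hg (hgt ▸ ht)
  rw [h (φ ∘ g) (by rwa [Function.comp_apply, hgt]), hgt] at h1
  simp [← h1]

end

theorem mainTheorem2 :
    IsGeneratingFamily canonicalFamily ∧
    ∀ J : JetFamily, IsGeneratingFamily J →
    ∀ κ : ℕ, 1 ≤ κ → ∀ d : ℕ, κ + 3 ≤ d →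
    ∀ F : MvPolynomial (Fin 3) ℂ, IsSmoothPlaneCurve F d → IsAdapted F d →
    ∀ l : ℕ, 1 ≤ l → l ≤ κ →
    ∃ ω : (ℂ → P2) → ℂ,
      (∀ f : ℂ → P2, IsCurveGerm (planeCurve F) f →
        (f 0 ∉ lineAtInfinity →
          partialDeriv (affineEq F) 1 0 (affX (f 0)) (affY (f 0)) ≠ 0 →
          ω f = ySide J l (affineEq F) (affX ∘ f) (affY ∘ f)) ∧
        (f 0 ∉ lineAtInfinity →
          partialDeriv (affineEq F) 0 1 (affX (f 0)) (affY (f 0)) ≠ 0 →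
          ω f = xSide J l (affineEq F) (affX ∘ f) (affY ∘ f)) ∧
        (f 0 ∈ lineAtInfinity → ω f = 0)) ∧
      IsHolomorphicJetDifferential (planeCurve F) l l ω ∧
      VanishesOn (planeCurve F) l l ω (planeCurve F ∩ lineAtInfinity) := by
  refine ⟨isGeneratingFamily_canonicalFamily, ?_⟩
  intro J hJ κ _ d hd F hF hA l hl hlκ
  refine ⟨curveJetDiff J l F, fun f hf => ⟨fun h hx => curveJetDiff_eq_ySide h hx,
    fun h hy => curveJetDiff_eq_xSide hJ hl hF.homogeneous hf h hy, curveJetDiff_of_mem⟩,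
    isHolomorphicJetDifferential_curveJetDiff hJ hl (by omega) hF hA,
    vanishesOn_of_forall_germ fun f hf => curveJetDiff_of_mem hf.2⟩
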